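/- **Setting.** Let $r\ge 2$, $1\le m_k\le n_k$ ($k=1,\dots,r$), $n=\prod_k n_k$, $m=\prod_k m_k$, $\mathbb U=\mathbb R^{m_1\times\cdots\times m_r}$, $\mathbb V=\mathbb R^{n_1\times\cdots\times n_r}$. For $\boldsymbol A=(A_1,\dots,A_r)$ with $A_k\in\mathbb R^{n_k\times m_k}$, the Tucker map $\mathsf F_{\boldsymbol A}:\mathbb U\to\mathbb V$ has coordinates $\prod_k (A_k)_{i_kj_k}$. Let $\sigma\ge 0$, $N\ge 1$, and let $X_1,\dots,X_N$ be independent random tensors, each of the form $X_i=\mathsf F_{\boldsymbol A}Z_i+\varepsilon_i$ with $Z_i$ standard Gaussian on $\mathbb U$ and $\varepsilon_i$ Gaussian on $\mathbb V$ with mean $0$ and covariance $\sigma^2\mathbb I$, independent of $Z_i$. Put $B_k=A_kA_k^\top$, $\Sigma=\sigma^2\mathbb I+\mathsf F_{\boldsymbol A}\mathsf F_{\boldsymbol A}^*$, $\mathsf S_N=\frac1N\sum_i X_i\otimes X_i$, $\Phi=\sigma^2\mathbb I+\mathsf S_N-\Sigma$, $\omega=\prod_k\|B_k\|_F$, $\|\boldsymbol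 A\|=\prod_k\|A_k\|$ (spectral norms). For a linear map $\mathsf F$ on $\mathbb V$ let $\|\mathsf F\|_{\rm ml}=\max\langle\mathsf F(u_1\otimes\cdots\otimes u_r),v_1\otimes\cdots\otimes v_r\rangle$ over vectors with $\|u_k\|,\|v_k\|\le1$, and for $n_k\times n_k$ matrices $C_k$ write $\langle C_1,\dots,C_r;\mathsf F\rangle=\sum_{i,j}\prod_k (C_k)_{i_kj_k}\mathsf F_{i_1\ldots i_r,j_1\ldots j_r}$. For $\delta_1,\delta_2,\delta_3\in(0,1)$ let $$\psi=\sigma^2+2\sigma^2\max\{\alpha_1,\sqrt{\alpha_1}\}+2\|\boldsymbol A\|^2\max\{\alpha_2,\sqrt{\alpha_2}\}+4\sigma\|\boldsymbol A\|\max\{\alpha_3,\sqrt{\alpha_3}\},$$ $$\alpha_1=\tfrac{2\log(10r)\sum_k n_k+\log(1/\delta_1)}{0.145N},\quad \alpha_2=\tfrac{2\log(10r)\sum_k m_k+\log(1/\delta_2)}{0.145N},\quad \alpha_3=\tfrac3N\Big(\log(10r)\sum_k(n_k+m_k)+\log\tfrac1{\delta_3}\Big),$$ and let $\boldsymbol E(\psi)=\{\|\Phi\|_{\rm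 ml}\le\psi\}$. **One iteration.** Given positive semidefinite $B_k^{(0)}$ with $\operatorname{rank}B_k^{(0)}\le m_k$ and $\|B_k^{(0)}\|_F=1$, let $\tilde B_k$ be the matrix with $\langle\tilde B_k,C\rangle=\langle B_1^{(0)},\dots,B_{k-1}^{(0)},C,B_{k+1}^{(0)},\dots,B_r^{(0)};\mathsf S_N\rangle$ for all $C$, let $\mathrm{Eig}_{m_k}(\tilde B_k)$ keep the top $m_k$ eigenpairs of $\tilde B_k$ (ties broken arbitrarily), and set $B_k^{(1)}=\mathrm{Eig}_{m_k}(\tilde B_k)/\|\mathrm{Eig}_{m_k}(\tilde B_k)\|_F$. Put $\widehat\omega=\langle B_1^{(1)},\dots,B_r^{(1)};\mathsf S_N\rangle$, $\widehat B_k=\widehat\omega^{1/r}B_k^{(1)}$ and $\widehat{\sigma^2}=\frac1n\operatorname{tr}(\mathsf S_N-\mathsf F_{\widehat{\boldsymbol B}})$. **Assumptions.** (i) Equal scaling: $\|B_1\|_F=\cdots=\|B_r\|_F>0$. (ii) Initialization: $(\psi/\omega)^2<\frac1{32m}\cdot\frac1r(1-\frac1r)^{r-1}$, and $0<\tau<\tau_1$,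 where $\tau_1$ is the right end point of the interval of those $x\in(0,1)$ with $x^2(1-x^2)^{r-1}>32m(\psi/\omega)^2$; the angle $\theta_k^{(0)}$ between $\operatorname{vec}(B_k)$ and $\operatorname{vec}(B_k^{(0)})$ satisfies $\sin\theta_k^{(0)}\le\tau$ for all $k$. **Theorem.** There is an event $G$ with $\mathbb P(G)\ge 1-\frac1{N^2n^2}$ such that on $G\cap\boldsymbol E(\psi)$, for all initial matrices as above, $$|\widehat{\sigma^2}-\sigma^2|\le\frac{\sqrt m\,\omega}{n}\Big[\big(1+2f_1(\tau)+\sqrt2f_2(\tau)\big)^r-1\Big]+t_4,$$ where $$f_1(\tau)=\frac\psi\omega\,\frac{4\sqrt{2m}}{(1-\tau^2)^{(r-1)/2}},\qquad f_2(\tau)=\Big(\frac\psi\omega\Big)^2\frac{16mr}{(1-\tau^2)^{r-1}}+\frac\psi\omega\sqrt m,$$ $$t_4=\frac Dn\max\{\alpha_4,\sqrt{\alpha_4}\},\qquad \alpha_4=\frac{2\|\Sigma\|\log(Nn)}{0.145\,N D},\qquad D=m\|\Sigma\|+\frac{(n-m)\sigma^4}{\|\Sigma\|}.$$ -/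

import Mathlib

open MeasureTheory ProbabilityTheory
open scoped BigOperators Matrix

noncomputable section

namespace TPCA

/-! ### Tensors and linear maps between tensor spaces -/

/-- Multi-indices `(i₁, …, i_r)` of an `n₁ × ⋯ × n_r` tensor. -/
abbrev Idx {r : ℕ} (n : Fin r → ℕ) : Type := (k : Fin r) → Fin (n k)

/-- The tensor space `ℝ^{n₁ × ⋯ × n_r}` with its Frobenius inner product. -/
abbrev Tensor {r : ℕ} (n : Fin r → ℕ) : Type := EuclideanSpace ℝ (Idx n)

/-- Linear maps `ℝ^{m₁ × ⋯ × m_r} → ℝ^{n₁ × ⋯ × n_r}`, given by their coordinates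
`F_{i₁…i_r, j₁…j_r}`; the action on tensors is `Matrix.toEuclideanLin`. -/
abbrev Op {r : ℕ} (m n : Fin r → ℕ) : Type := Matrix (Idx n) (Idx m) ℝ

/-- The Tucker map `T ↦ (A₁, …, A_r) · T`. -/
def tucker {r : ℕ} {n m : Fin r → ℕ} (A : (k : Fin r) → Matrix (Fin (n k)) (Fin (m k)) ℝ) :
    Op m n :=
  Matrix.of fun i j => ∏ k, A k (i k) (j k)

/-- The rank-one tensor `v₁ ⊗ ⋯ ⊗ v_r`. -/
def rankOne {r : ℕ} {n : Fin r → ℕ} (v : (k : Fin r) → EuclideanSpace ℝ (Fin (n k))) :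
    Tensor n :=
  WithLp.toLp 2 fun i => ∏ k, v k (i k)

/-- The multilinear spectral norm: the maximum of `⟨F(u₁ ⊗ ⋯ ⊗ u_r), v₁ ⊗ ⋯ ⊗ v_r⟩` over
vectors `u_k`, `v_k` of Euclidean norm at most one. -/
def mlNorm {r : ℕ} {n m : Fin r → ℕ} (F : Op m n) : ℝ :=
  sSup {x : ℝ | ∃ (u : (k : Fin r) → EuclideanSpace ℝ (Fin (m k)))
      (v : (k : Fin r) → EuclideanSpace ℝ (Fin (n k))),
      (∀ k, ‖u k‖ ≤ 1) ∧ (∀ k, ‖v k‖ ≤ 1) ∧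
        x = inner ℝ (Matrix.toEuclideanLin F (rankOne u)) (rankOne v)}

/-- The spectral norm of a (possibly rectangular) matrix. -/
def opNorm {α β : Type*} [Fintype α] [Fintype β] [DecidableEq β] (M : Matrix α β ℝ) : ℝ :=
  ‖LinearMap.toContinuousLinearMap (Matrix.toEuclideanLin M)‖

/-- Vectorization of a matrix, with entries indexed by pairs. -/
def vec {p q : ℕ} (M : Matrix (Fin p) (Fin q) ℝ) : EuclideanSpace ℝ (Fin p × Fin q) :=
  WithLp.toLp 2 fun x => M x.1 x.2

/-- The Frobenius norm. -/
def frob {p q : ℕ} (M : Matrix (Fin p) (Fin q) ℝ) : ℝ := ‖vec M‖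

/-- The flattening of a linear map that pairs the corresponding modes. -/
def pair {r : ℕ} {n m : Fin r → ℕ} (F : Op m n) :
    ((k : Fin r) → Fin (n k) × Fin (m k)) → ℝ :=
  fun p => F (fun k => (p k).1) (fun k => (p k).2)

/-! ### The probabilistic model -/

/-- `X` is Gaussian on the tensor space with mean `μ` and covariance operator `S`: every
`⟨X, T⟩` is normal with mean `⟨μ, T⟩` and variance `⟨S T, T⟩`. -/
def IsGaussianTensor {Ω : Type*} [MeasurableSpace Ω] (P : Measure Ω) {r : ℕ} {n : Fin r → ℕ}
    (X : Ω → Tensor n) (μ : Tensor n) (S : Op n n) : Prop :=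
  AEMeasurable X P ∧ ∀ T : Tensor n,
    P.map (fun ω => (inner ℝ (X ω) T : ℝ)) =
      gaussianReal (inner ℝ μ T) (Real.toNNReal (inner ℝ (Matrix.toEuclideanLin S T) T))

/-- `X = μ + A · Z + ε` with `μ = A · ν` for some `ν`, `Z` standard Gaussian, `ε` Gaussian with
mean zero and covariance `σ² I`, and `Z`, `ε` independent. -/
def IsTPCA {Ω : Type*} [MeasurableSpace Ω] (P : Measure Ω) {r : ℕ} {n m : Fin r → ℕ}
    (X : Ω → Tensor n) (μ : Tensor n)
    (A : (k : Fin r) → Matrix (Fin (n k)) (Fin (m k)) ℝ) (σ : ℝ) : Prop :=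
  (∃ ν : Tensor m, μ = Matrix.toEuclideanLin (tucker A) ν) ∧
    ∃ (Z : Ω → Tensor m) (ε : Ω → Tensor n),
      IsGaussianTensor P Z 0 (1 : Op m m) ∧
      IsGaussianTensor P ε 0 (σ ^ 2 • (1 : Op n n)) ∧
      IndepFun Z ε P ∧
      ∀ᵐ ω ∂P, X ω = μ + Matrix.toEuclideanLin (tucker A) (Z ω) + ε ω

/-- `B_k = A_k A_kᵀ`. -/
def gram {r : ℕ} {n m : Fin r → ℕ} (A : (k : Fin r) → Matrix (Fin (n k)) (Fin (m k)) ℝ)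
    (k : Fin r) : Matrix (Fin (n k)) (Fin (n k)) ℝ :=
  A k * (A k)ᵀ

/-- The covariance operator `Σ = σ² I + F_A F_A^*`. -/
def cov {r : ℕ} {n m : Fin r → ℕ} (A : (k : Fin r) → Matrix (Fin (n k)) (Fin (m k)) ℝ)
    (σ : ℝ) : Op n n :=
  σ ^ 2 • (1 : Op n n) + tucker A * (tucker A)ᵀ

/-- The sample covariance `S_N = N⁻¹ ∑ X_i ⊗ X_i`. -/
def sampleCov {r : ℕ} {n : Fin r → ℕ} {N : ℕ} (x : Fin N → Tensor n) : Op n n :=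
  Matrix.of fun a b => (1 / (N : ℝ)) * ∑ i, x i a * x i b

/-- `Φ = σ² I + S_N - Σ`. -/
def noise {r : ℕ} {n m : Fin r → ℕ} (A : (k : Fin r) → Matrix (Fin (n k)) (Fin (m k)) ℝ)
    (σ : ℝ) {N : ℕ} (x : Fin N → Tensor n) : Op n n :=
  σ ^ 2 • (1 : Op n n) + sampleCov x - cov A σ

/-- The signal strength `ω = ∏ ‖B_k‖_F`. -/
def signal {r : ℕ} {n m : Fin r → ℕ} (A : (k : Fin r) → Matrix (Fin (n k)) (Fin (m k)) ℝ) : ℝ :=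
  ∏ k, frob (gram A k)

/-! ### The rank-one power iteration -/

/-- `B̃_k`, the matrix form of `(b₁ᵀ, …, b_{k-1}ᵀ, I, b_{k+1}ᵀ, …, b_rᵀ) · pair(S)`. -/
def powerUpdate {r : ℕ} {n : Fin r → ℕ} (S : Op n n)
    (B : (k : Fin r) → Matrix (Fin (n k)) (Fin (n k)) ℝ) (k : Fin r) :
    Matrix (Fin (n k)) (Fin (n k)) ℝ :=
  Matrix.of fun a b => ∑ p : (l : Fin r) → Fin (n l) × Fin (n l),
    if p k = (a, b) then (∏ l ∈ Finset.univ.erase k, B l (p l).1 (p l).2) * pair S p else 0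

/-- `E` keeps the top `d` eigenpairs of the symmetric matrix `M` (for some spectral
decomposition of `M` with decreasing eigenvalues) and zeroes out the rest. -/
def IsEigTrunc {p : ℕ} (d : ℕ) (M E : Matrix (Fin p) (Fin p) ℝ) : Prop :=
  ∃ (u : Fin p → EuclideanSpace ℝ (Fin p)) (lam : Fin p → ℝ),
    Orthonormal ℝ u ∧ Antitone lam ∧
    M = ∑ j, lam j • Matrix.vecMulVec (fun a => u j a) (fun a => u j a) ∧
    E = ∑ j : Fin p, if (j : ℕ) < d then
      lam j • Matrix.vecMulVec (fun a => u j a) (fun a => u j a) else 0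

/-- One iteration of the algorithm turns the matrices `B` into the matrices `B'`. -/
def IsIteration {r : ℕ} {n : Fin r → ℕ} (m : Fin r → ℕ) (S : Op n n)
    (B B' : (k : Fin r) → Matrix (Fin (n k)) (Fin (n k)) ℝ) : Prop :=
  ∀ k, ∃ E : Matrix (Fin (n k)) (Fin (n k)) ℝ,
    IsEigTrunc (m k) (powerUpdate S B k) E ∧ B' k = (frob E)⁻¹ • E

/-- Admissible initial matrices: positive semidefinite, of rank at most `m_k` and of unit
Frobenius norm. -/
def IsFeasible {r : ℕ} {n : Fin r → ℕ} (m : Fin r → ℕ)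
    (B : (k : Fin r) → Matrix (Fin (n k)) (Fin (n k)) ℝ) : Prop :=
  ∀ k, (B k).PosSemidef ∧ (B k).rank ≤ m k ∧ frob (B k) = 1

/-- `ω̂ = (b̂₁ᵀ, …, b̂_rᵀ) · pair(S)`. -/
def signalHat {r : ℕ} {n : Fin r → ℕ} (S : Op n n)
    (B : (k : Fin r) → Matrix (Fin (n k)) (Fin (n k)) ℝ) : ℝ :=
  ∑ p : (l : Fin r) → Fin (n l) × Fin (n l), (∏ l, B l (p l).1 (p l).2) * pair S p

/-- `B̂_k = ω̂^{1/r} B_k`, computed from the last iterate `B`. -/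
def gramHat {r : ℕ} {n : Fin r → ℕ} (S : Op n n)
    (B : (k : Fin r) → Matrix (Fin (n k)) (Fin (n k)) ℝ) (k : Fin r) :
    Matrix (Fin (n k)) (Fin (n k)) ℝ :=
  signalHat S B ^ (1 / (r : ℝ)) • B k

/-- The residual estimator `n⁻¹ tr(S - F_{B̂})` of `σ²`, computed from the last iterate `B`. -/
def sigmaSqHat {r : ℕ} {n : Fin r → ℕ} (S : Op n n)
    (B : (k : Fin r) → Matrix (Fin (n k)) (Fin (n k)) ℝ) : ℝ :=
  (1 / (∏ k, (n k : ℝ))) * Matrix.trace (S - tucker (gramHat S B))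

/-- The angle between `vec(B_k) / ‖B_k‖_F` and `vec(M)`. -/
def initAngle {r : ℕ} {n m : Fin r → ℕ}
    (A : (k : Fin r) → Matrix (Fin (n k)) (Fin (m k)) ℝ) (k : Fin r)
    (M : Matrix (Fin (n k)) (Fin (n k)) ℝ) : ℝ :=
  InnerProductGeometry.angle ((frob (gram A k))⁻¹ • vec (gram A k)) (vec M)

/-! ### The explicit quantities of the bound -/

/-- `‖A‖ = ∏ ‖A_k‖`. -/
def loadNorm {r : ℕ} {n m : Fin r → ℕ}
    (A : (k : Fin r) → Matrix (Fin (n k)) (Fin (m k)) ℝ) : ℝ :=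
  ∏ k, opNorm (A k)

/-- `max {x, √x}`. -/
def maxSqrt (x : ℝ) : ℝ := max x (Real.sqrt x)

def alpha₁ {r : ℕ} (n : Fin r → ℕ) (N : ℕ) (δ : ℝ) : ℝ :=
  1 / (0.145 * (N : ℝ)) * (2 * Real.log (10 * (r : ℝ)) * ∑ k, (n k : ℝ) + Real.log (1 / δ))

def alpha₂ {r : ℕ} (m : Fin r → ℕ) (N : ℕ) (δ : ℝ) : ℝ :=
  1 / (0.145 * (N : ℝ)) * (2 * Real.log (10 * (r : ℝ)) * ∑ k, (m k : ℝ) + Real.log (1 / δ))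

def alpha₃ {r : ℕ} (n m : Fin r → ℕ) (N : ℕ) (δ : ℝ) : ℝ :=
  3 / (N : ℝ) * (Real.log (10 * (r : ℝ)) * ∑ k, ((n k : ℝ) + (m k : ℝ)) + Real.log (1 / δ))

/-- The noise level `ψ = σ² + t₁ + t₂ + t₃`. -/
def psi {r : ℕ} {n m : Fin r → ℕ} (A : (k : Fin r) → Matrix (Fin (n k)) (Fin (m k)) ℝ)
    (σ : ℝ) (N : ℕ) (δ₁ δ₂ δ₃ : ℝ) : ℝ :=
  σ ^ 2 + 2 * σ ^ 2 * maxSqrt (alpha₁ n N δ₁)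
    + 2 * loadNorm A ^ 2 * maxSqrt (alpha₂ m N δ₂)
    + 4 * σ * loadNorm A * maxSqrt (alpha₃ n m N δ₃)

/-- `g(x) = x²(1 - x²)^{r-1} - 32 m ρ²`, where `M = m` and `ρ = ψ/ω`. -/
def gFun (r : ℕ) (M ρ x : ℝ) : ℝ := x ^ 2 * (1 - x ^ 2) ^ (r - 1) - 32 * M * ρ ^ 2

/-- The right end point `τ₁(ρ)` of the interval in `(0, 1)` on which `g` is positive. -/
def tauOne (r : ℕ) (M ρ : ℝ) : ℝ := sSup {x : ℝ | 0 < x ∧ x < 1 ∧ 0 < gFun r M ρ x}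

/-- `f₁(τ) = ρ · 4√(2m) / (1 - τ²)^{(r-1)/2}`, where `M = m` and `ρ = ψ/ω`. -/
def f₁ (r : ℕ) (M ρ τ : ℝ) : ℝ :=
  ρ * (4 * Real.sqrt (2 * M) / (1 - τ ^ 2) ^ (((r : ℝ) - 1) / 2))

/-- `f₂(τ) = ρ² · 16 m r / (1 - τ²)^{r-1} + ρ √m`, where `M = m` and `ρ = ψ/ω`. -/
def f₂ (r : ℕ) (M ρ τ : ℝ) : ℝ :=
  ρ ^ 2 * (16 * M * (r : ℝ) / (1 - τ ^ 2) ^ (r - 1)) + ρ * Real.sqrt M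

/-- `D = m ‖Σ‖ + (n - m) σ⁴ / ‖Σ‖`. -/
def effDim {r : ℕ} {n m : Fin r → ℕ} (A : (k : Fin r) → Matrix (Fin (n k)) (Fin (m k)) ℝ)
    (σ : ℝ) : ℝ :=
  (∏ k, (m k : ℝ)) * opNorm (cov A σ)
    + ((∏ k, (n k : ℝ)) - ∏ k, (m k : ℝ)) * σ ^ 4 / opNorm (cov A σ)

/-- `α₄ = 2 ‖Σ‖ log(N n) / (0.145 N D)`. -/
def alpha₄ {r : ℕ} {n m : Fin r → ℕ} (A : (k : Fin r) → Matrix (Fin (n k)) (Fin (m k)) ℝ)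
    (σ : ℝ) (N : ℕ) : ℝ :=
  2 * opNorm (cov A σ) * Real.log ((N : ℝ) * ∏ k, (n k : ℝ)) / (0.145 * (N : ℝ) * effDim A σ)

/-- `t₄ = (D / n) max {α₄, √α₄}`. -/
def t₄ {r : ℕ} {n m : Fin r → ℕ} (A : (k : Fin r) → Matrix (Fin (n k)) (Fin (m k)) ℝ)
    (σ : ℝ) (N : ℕ) : ℝ :=
  effDim A σ / (∏ k, (n k : ℝ)) * maxSqrt (alpha₄ A σ N)

end TPCA

end

namespace TPCA

/-!
Multiplied by `n`, the error of the variance estimate is the difference of `tr S_N - tr Σ` and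
`tr F_B̂ - tr F_B`.

The first term is a centred Gaussian quadratic form: in an eigenbasis of `Σ`, the trace of `N S_N`
is a sum of independent squares of centred Gaussian variables whose variances are the eigenvalues
of `Σ`. All but `m` of these equal `σ²` and none exceeds `‖Σ‖`, so their squares sum to at most
`D ‖Σ‖`, and Chernoff bounds for weighted chi-square sums give the event `G`.

The second term is bounded deterministically. As `S_N = F_B + Φ`, contracting all modes but the
`k`-th yields a positive multiple of `B_k` plus an error of numerical radius at most
`√(m / m_k) ‖Φ‖_ml`. By Weyl's inequality the eigenvalues that truncation discards are at most this
error, which makes the sine of the angle between `B_k⁽¹⁾` and `B_k` at most `f₁(τ) / 2`. Then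
`f₂(τ)` controls `ω̂ / ω`, and the traces `tr B̂_k` are multiplied up to the trace of the
Kronecker product.
-/

/-! ### Elementary inequalities -/

theorem one_sub_mul_le_sqrt_pow {y : ℝ} (hy₀ : 0 ≤ y) (hy₁ : y ≤ 1) (r : ℕ) :
    1 - r * y ≤ √(1 - y) ^ r := by
  have hsqrt : 1 - y ≤ √(1 - y) := Real.le_sqrt_of_sq_le (by nlinarith)
  calc 1 - r * y = 1 + r * (-y) := by ring
    _ ≤ (1 + -y) ^ r := one_add_mul_le_pow (by linarith) r
    _ ≤ √(1 - y) ^ r := pow_le_pow_left₀ (by linarith) (by linarith) r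

theorem abs_rpow_sub_one_le {t p : ℝ} (ht : 0 ≤ t) (hp₀ : 0 ≤ p) (hp₁ : p ≤ 1) :
    |t ^ p - 1| ≤ |t - 1| := by
  rcases le_total t 1 with h | h
  · have hle : t ≤ t ^ p := Real.self_le_rpow_of_le_one ht h hp₁
    have hone : t ^ p ≤ 1 := Real.rpow_le_one ht h hp₀
    rw [abs_of_nonpos (by linarith), abs_of_nonpos (by linarith)]
    linarith
  · have hle : t ^ p ≤ t := Real.rpow_le_self_of_one_le h hp₁
    have hone : 1 ≤ t ^ p := Real.one_le_rpow h hp₀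
    rw [abs_of_nonneg (by linarith), abs_of_nonneg (by linarith)]
    linarith

theorem abs_prod_sub_prod_le {ι : Type*} (s : Finset ι) {x y Y : ι → ℝ} {η : ℝ}
    (hy : ∀ i, |y i| ≤ Y i) (hxy : ∀ i, |x i - y i| ≤ Y i * η) :
    |∏ i ∈ s, x i - ∏ i ∈ s, y i| ≤ (∏ i ∈ s, Y i) * ((1 + η) ^ s.card - 1) := by
  classical
  induction s using Finset.induction_on with
  | empty => simp
  | insert a s ha ih =>
    rw [Finset.prod_insert ha, Finset.prod_insert ha, Finset.prod_insert ha,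
      Finset.card_insert_of_notMem ha]
    have hprod : |∏ i ∈ s, y i| ≤ ∏ i ∈ s, Y i := by
      rw [Finset.abs_prod]
      exact Finset.prod_le_prod (fun _ _ => abs_nonneg _) fun i _ => hy i
    have hx : |x a| ≤ Y a * (1 + η) := by
      have := abs_sub_abs_le_abs_sub (x a) (y a)
      linarith [hy a, hxy a]
    calc |x a * ∏ i ∈ s, x i - y a * ∏ i ∈ s, y i|
        = |x a * (∏ i ∈ s, x i - ∏ i ∈ s, y i) + (x a - y a) * ∏ i ∈ s, y i| := by ring_nf
      _ ≤ |x a| * |∏ i ∈ s, x i - ∏ i ∈ s, y i| + |x a - y a| * |∏ i ∈ s, y i| := by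
          rw [← abs_mul, ← abs_mul]
          exact abs_add_le _ _
      _ ≤ Y a * (1 + η) * ((∏ i ∈ s, Y i) * ((1 + η) ^ s.card - 1))
          + Y a * η * ∏ i ∈ s, Y i :=
          add_le_add (mul_le_mul hx ih (abs_nonneg _) ((abs_nonneg _).trans hx))
            (mul_le_mul (hxy a) hprod (abs_nonneg _) ((abs_nonneg _).trans (hxy a)))
      _ = Y a * (∏ i ∈ s, Y i) * ((1 + η) ^ (s.card + 1) - 1) := by ring

theorem sqrt_le_inner_of_norm_sub_le {V : Type*} [NormedAddCommGroup V] [InnerProductSpace ℝ V]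
    {e b : V} {κ s : ℝ} (hb : ‖b‖ = 1) (hκ : 0 < κ) (hs₀ : 0 ≤ s) (hs₁ : s < 1)
    (h : ‖e - κ • b‖ ≤ κ * s) :
    e ≠ 0 ∧ √(1 - s ^ 2) ≤ inner ℝ (‖e‖⁻¹ • e) b := by
  have he : e ≠ 0 := by
    rintro rfl
    rw [zero_sub, norm_neg, norm_smul, hb, Real.norm_eq_abs, abs_of_pos hκ] at h
    nlinarith
  refine ⟨he, ?_⟩
  have hsq : ‖e - κ • b‖ ^ 2 ≤ (κ * s) ^ 2 := pow_le_pow_left₀ (norm_nonneg _) h 2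
  rw [norm_sub_sq_real, norm_smul, hb, inner_smul_right, Real.norm_eq_abs, abs_of_pos hκ] at hsq
  have hq := Real.sq_sqrt (show 0 ≤ 1 - s ^ 2 by nlinarith)
  set q := √(1 - s ^ 2)
  rw [inner_smul_left, conj_trivial, inv_mul_eq_div, le_div_iff₀ (norm_pos_iff.2 he)]
  have hmul : κ * (q * ‖e‖) ≤ κ * inner ℝ e b := by
    nlinarith [sq_nonneg (‖e‖ - κ * q)]
  exact le_of_mul_le_mul_left hmul hκ

theorem norm_sub_le_sqrt_two_mul {V : Type*} [NormedAddCommGroup V] [InnerProductSpace ℝ V]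
    {a b : V} {s : ℝ} (ha : ‖a‖ = 1) (hb : ‖b‖ = 1) (hs₀ : 0 ≤ s) (hs₁ : s ≤ 1)
    (h : √(1 - s ^ 2) ≤ inner ℝ a b) : ‖a - b‖ ≤ √2 * s := by
  have hs_sq : s ^ 2 ≤ 1 := pow_le_one₀ hs₀ hs₁
  have hsqrt : 1 - s ^ 2 ≤ √(1 - s ^ 2) := Real.le_sqrt_of_sq_le (by nlinarith [sq_nonneg s])
  refine abs_le_of_sq_le_sq' ?_ (by positivity) |>.2
  rw [norm_sub_sq_real, ha, hb, mul_pow, Real.sq_sqrt (by norm_num)]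
  linarith

/-! ### Rank and eigenvalues of symmetric matrices -/

section Rank

variable {K α β : Type*} [Field K] [Fintype β]

theorem matrixRank_add_le (M M' : Matrix α β K) :
    (M + M').rank ≤ M.rank + M'.rank := by
  rw [Matrix.rank, Matrix.rank, Matrix.rank, Matrix.mulVecLin_add]
  exact (Submodule.finrank_mono (LinearMap.range_add_le _ _)).trans
    (Submodule.finrank_add_le_finrank_add_finrank _ _)

theorem matrixRank_smul_le (c : K) (M : Matrix α β K) : (c • M).rank ≤ M.rank := by
  classical
  simpa using Matrix.rank_mul_le_left M (c • (1 : Matrix β β K))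

theorem matrixRank_sub_le (M M' : Matrix α β K) :
    (M - M').rank ≤ M.rank + M'.rank := by
  rw [sub_eq_add_neg, ← neg_one_smul K M']
  exact (matrixRank_add_le _ _).trans (Nat.add_le_add_left (matrixRank_smul_le _ _) _)

theorem matrixRank_sum_le {κ : Type*} (s : Finset κ) (M : κ → Matrix α β K) :
    (∑ j ∈ s, M j).rank ≤ ∑ j ∈ s, (M j).rank :=
  Finset.le_sum_of_subadditive _ Matrix.rank_zero.le matrixRank_add_le s M

end Rank

section Spectral

theorem isHermitian_vecMulVec_self {ι : Type*} (x : ι → ℝ) :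
    (Matrix.vecMulVec x x).IsHermitian := by
  ext a b
  simp [Matrix.vecMulVec_apply, mul_comm]

variable {ι : Type*} [Fintype ι]

theorem dotProduct_self_nonneg (x : ι → ℝ) : 0 ≤ x ⬝ᵥ x :=
  Finset.sum_nonneg fun _ _ => mul_self_nonneg _

theorem dotProduct_sum_vecMulVec_mulVec {κ : Type*} [Fintype κ] (u : κ → ι → ℝ) (lam : κ → ℝ)
    (x : ι → ℝ) :
    x ⬝ᵥ (∑ j, lam j • Matrix.vecMulVec (u j) (u j)) *ᵥ x = ∑ j, lam j * (u j ⬝ᵥ x) ^ 2 := by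
  rw [Matrix.sum_mulVec, dotProduct_sum]
  refine Finset.sum_congr rfl fun j _ => ?_
  rw [Matrix.smul_mulVec, Matrix.vecMulVec_mulVec, op_smul_eq_smul, dotProduct_smul,
    dotProduct_smul, dotProduct_comm x, smul_eq_mul, smul_eq_mul, sq]

variable [DecidableEq ι] {M : Matrix ι ι ℝ}

theorem eq_sum_eigenvalues_smul_vecMulVec (hM : M.IsHermitian) :
    M = ∑ j, hM.eigenvalues j •
      Matrix.vecMulVec (hM.eigenvectorBasis j).ofLp (hM.eigenvectorBasis j).ofLp := by
  conv_lhs => rw [hM.spectral_theorem]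
  ext a b
  simp only [Unitary.conjStarAlgAut_apply, Matrix.mul_apply, Matrix.sum_apply,
    Matrix.smul_apply, Matrix.vecMulVec_apply, Matrix.diagonal_apply, Matrix.star_apply,
    Matrix.IsHermitian.eigenvectorUnitary_apply, star_trivial, Function.comp_apply, mul_ite,
    mul_zero, Finset.sum_ite_eq', Finset.mem_univ, if_true, smul_eq_mul, RCLike.ofReal_real_eq_id,
    id_eq]
  exact Finset.sum_congr rfl fun j _ => by ring

theorem sum_sq_eq_sum_eigenvalues_sq (hM : M.IsHermitian) :
    ∑ a, ∑ b, M a b ^ 2 = ∑ j, hM.eigenvalues j ^ 2 := by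
  have htrace : ∑ a, ∑ b, M a b ^ 2 = (M * M).trace := by
    simp only [Matrix.trace, Matrix.diag, Matrix.mul_apply]
    refine Finset.sum_congr rfl fun a _ => Finset.sum_congr rfl fun b _ => ?_
    rw [sq, ← hM.apply a b, star_trivial]
  rw [htrace]
  conv_lhs => rw [hM.spectral_theorem]
  rw [← map_mul, Unitary.conjStarAlgAut_apply, Matrix.trace_mul_cycle]
  simp [Matrix.trace, sq]

theorem card_eigenvalues_ne (hM : M.IsHermitian) (c : ℝ) :
    (Finset.univ.filter fun j => hM.eigenvalues j ≠ c).card = (M - c • 1).rank := by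
  have hdiag : M - c • 1 = Unitary.conjStarAlgAut ℝ _ hM.eigenvectorUnitary
      (Matrix.diagonal fun j => hM.eigenvalues j - c) := by
    rw [← Matrix.diagonal_sub, ← Matrix.smul_one_eq_diagonal, map_sub, map_smul, map_one]
    congr 1
    exact hM.spectral_theorem
  rw [hdiag, Unitary.conjStarAlgAut_apply, ← Unitary.coe_star]
  simp [-isUnit_iff_ne_zero, -Unitary.coe_star, Matrix.rank_diagonal, sub_eq_zero,
    Fintype.card_subtype]

theorem sum_eigenvalues_sq_le (hM : M.IsHermitian) {d : ℕ} {c L : ℝ} (hd : (M - c • 1).rank ≤ d)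
    (hc : |c| ≤ L) (hL : ∀ j, |hM.eigenvalues j| ≤ L) :
    ∑ j, hM.eigenvalues j ^ 2 ≤ d * L ^ 2 + (Fintype.card ι - d) * c ^ 2 := by
  set s := Finset.univ.filter fun j => hM.eigenvalues j ≠ c
  have hcL : c ^ 2 ≤ L ^ 2 := sq_le_sq.2 (hc.trans (le_abs_self L))
  have hexcess : ∑ j, (hM.eigenvalues j ^ 2 - c ^ 2) ≤ d * (L ^ 2 - c ^ 2) := by
    calc ∑ j, (hM.eigenvalues j ^ 2 - c ^ 2)
        = ∑ j ∈ s, (hM.eigenvalues j ^ 2 - c ^ 2) := by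
          refine (Finset.sum_filter_of_ne (p := fun j => hM.eigenvalues j ≠ c) ?_).symm
          intro _ _ hj hjc
          exact hj (by rw [hjc, sub_self])
      _ ≤ ∑ _j ∈ s, (L ^ 2 - c ^ 2) := Finset.sum_le_sum fun j _ =>
          sub_le_sub_right (sq_le_sq.2 ((hL j).trans (le_abs_self L))) _
      _ = s.card * (L ^ 2 - c ^ 2) := by rw [Finset.sum_const, nsmul_eq_mul]
      _ ≤ d * (L ^ 2 - c ^ 2) := by
          have hcard : s.card ≤ d := (card_eigenvalues_ne hM c).trans_le hd
          exact mul_le_mul_of_nonneg_right (mod_cast hcard) (sub_nonneg.2 hcL)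
  rw [Finset.sum_sub_distrib, Finset.sum_const, nsmul_eq_mul, Finset.card_univ] at hexcess
  linarith

theorem sum_abs_eigenvalues_le (hM : M.IsHermitian) {d : ℕ} (hd : M.rank ≤ d) :
    ∑ j, |hM.eigenvalues j| ≤ √d * √(∑ a, ∑ b, M a b ^ 2) := by
  rw [← Real.sqrt_mul (by positivity), sum_sq_eq_sum_eigenvalues_sq hM]
  refine Real.le_sqrt_of_sq_le ?_
  set s := Finset.univ.filter fun j => hM.eigenvalues j ≠ 0
  have hcard : s.card ≤ d := by
    rw [card_eigenvalues_ne hM 0, zero_smul, sub_zero]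
    exact hd
  calc (∑ j, |hM.eigenvalues j|) ^ 2 = (∑ j ∈ s, |hM.eigenvalues j|) ^ 2 := by
        rw [Finset.sum_filter_of_ne fun j _ hj => abs_ne_zero.1 hj]
    _ ≤ s.card * ∑ j ∈ s, |hM.eigenvalues j| ^ 2 := sq_sum_le_card_mul_sum_sq
    _ ≤ d * ∑ j, hM.eigenvalues j ^ 2 := by
        simp only [sq_abs]
        gcongr
        exact Finset.subset_univ _

end Spectral

section NumericalRadius

variable {ι : Type*} [Fintype ι] {M M' : Matrix ι ι ℝ} {e e' : ℝ}

/-- The numerical radius of `M` is at most `e`. For symmetric `M` this bounds the spectral norm,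
but without reference to an operator norm on matrices. -/
def NumericalRadiusLE (M : Matrix ι ι ℝ) (e : ℝ) : Prop :=
  ∀ x : ι → ℝ, |x ⬝ᵥ M *ᵥ x| ≤ e * (x ⬝ᵥ x)

theorem NumericalRadiusLE.add (h : NumericalRadiusLE M e) (h' : NumericalRadiusLE M' e') :
    NumericalRadiusLE (M + M') (e + e') := by
  intro x
  rw [Matrix.add_mulVec, dotProduct_add, add_mul]
  exact (abs_add_le _ _).trans (add_le_add (h x) (h' x))

theorem NumericalRadiusLE.abs_eigenvalues_le [DecidableEq ι] (h : NumericalRadiusLE M e)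
    (hM : M.IsHermitian) (j : ι) : |hM.eigenvalues j| ≤ e := by
  have hunit : (hM.eigenvectorBasis j).ofLp ⬝ᵥ (hM.eigenvectorBasis j).ofLp = 1 := by
    have := hM.eigenvectorBasis.orthonormal.1 j
    rw [EuclideanSpace.norm_eq, Real.sqrt_eq_one] at this
    simpa [dotProduct, sq] using this
  have hj := h (hM.eigenvectorBasis j).ofLp
  rw [hM.mulVec_eigenvectorBasis, dotProduct_smul, hunit] at hj
  simpa using hj

theorem NumericalRadiusLE.sum_sq_le (h : NumericalRadiusLE M e) (hM : M.IsHermitian) (he : 0 ≤ e)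
    {d : ℕ} (hd : M.rank ≤ d) : ∑ a, ∑ b, M a b ^ 2 ≤ d * e ^ 2 := by
  classical
  rw [sum_sq_eq_sum_eigenvalues_sq hM]
  have hrank : (M - (0 : ℝ) • 1).rank ≤ d := by rwa [zero_smul, sub_zero]
  simpa using sum_eigenvalues_sq_le hM hrank (by simpa using he) (h.abs_eigenvalues_le hM)

end NumericalRadius

/-! ### The Frobenius norm -/

section Frobenius

variable {p q : ℕ}

theorem frob_sq (M : Matrix (Fin p) (Fin q) ℝ) : frob M ^ 2 = ∑ a, ∑ b, M a b ^ 2 := by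
  rw [frob, EuclideanSpace.norm_sq_eq, Fintype.sum_prod_type]
  simp [vec]

theorem frob_nonneg (M : Matrix (Fin p) (Fin q) ℝ) : 0 ≤ frob M := norm_nonneg _

theorem frob_eq_sqrt (M : Matrix (Fin p) (Fin q) ℝ) : frob M = √(∑ a, ∑ b, M a b ^ 2) := by
  rw [← frob_sq, Real.sqrt_sq (frob_nonneg M)]

theorem vec_sub (M M' : Matrix (Fin p) (Fin q) ℝ) : vec (M - M') = vec M - vec M' := rfl

theorem vec_smul (c : ℝ) (M : Matrix (Fin p) (Fin q) ℝ) : vec (c • M) = c • vec M := rfl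

theorem inner_vec (M M' : Matrix (Fin p) (Fin q) ℝ) :
    inner ℝ (vec M) (vec M') = ∑ a, ∑ b, M a b * M' a b := by
  rw [PiLp.inner_apply, Fintype.sum_prod_type]
  simp [vec, mul_comm]

theorem frob_inv_frob_smul {M : Matrix (Fin p) (Fin q) ℝ} (hM : frob M ≠ 0) :
    frob ((frob M)⁻¹ • M) = 1 := by
  rw [frob, vec_smul, norm_smul, norm_inv, frob, norm_norm]
  exact inv_mul_cancel₀ hM

theorem frob_vecMulVec_self (x : Fin p → ℝ) : frob (Matrix.vecMulVec x x) = x ⬝ᵥ x := by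
  have hsq : ∑ a, ∑ b, Matrix.vecMulVec x x a b ^ 2 = (x ⬝ᵥ x) ^ 2 := by
    simp only [Matrix.vecMulVec_apply, sq, dotProduct, Finset.sum_mul_sum, mul_mul_mul_comm]
  rw [frob_eq_sqrt, hsq, Real.sqrt_sq (dotProduct_self_nonneg x)]

theorem abs_trace_le_sqrt_mul_frob {M : Matrix (Fin p) (Fin p) ℝ} (hM : M.IsHermitian) {d : ℕ}
    (hd : M.rank ≤ d) : |M.trace| ≤ √d * frob M := by
  rw [hM.trace_eq_sum_eigenvalues, frob_eq_sqrt]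
  exact (Finset.abs_sum_le_sum_abs _ _).trans (sum_abs_eigenvalues_le hM hd)

end Frobenius

/-! ### Truncating the spectral decomposition -/

section Truncation

variable {p d : ℕ} {M E Q : Matrix (Fin p) (Fin p) ℝ}
  {u : Fin p → EuclideanSpace ℝ (Fin p)} {lam : Fin p → ℝ}

theorem inner_eq_dotProduct (x y : EuclideanSpace ℝ (Fin p)) :
    inner ℝ x y = x.ofLp ⬝ᵥ y.ofLp := by
  rw [EuclideanSpace.inner_eq_star_dotProduct, star_trivial, dotProduct_comm]

theorem sum_dotProduct_sq (hu : Orthonormal ℝ u) (x : Fin p → ℝ) :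
    ∑ j, ((u j).ofLp ⬝ᵥ x) ^ 2 = x ⬝ᵥ x := by
  let b := OrthonormalBasis.mk hu
    (hu.linearIndependent.span_eq_top_of_card_eq_finrank' (by simp)).ge
  have hb : ∀ j, b j = u j := fun j => by simp [b]
  have hparseval := b.sum_sq_inner_right (WithLp.toLp 2 x)
  rw [EuclideanSpace.real_norm_sq_eq] at hparseval
  simpa only [hb, inner_eq_dotProduct, dotProduct, sq] using hparseval

theorem IsEigTrunc.isHermitian (h : IsEigTrunc d M E) : E.IsHermitian := by
  obtain ⟨u, lam, -, -, -, rfl⟩ := h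
  refine isSelfAdjoint_sum (R := Matrix (Fin p) (Fin p) ℝ) Finset.univ fun j _ => ?_
  split_ifs
  · exact (IsSelfAdjoint.all (lam j)).smul (isHermitian_vecMulVec_self _)
  · exact IsSelfAdjoint.zero _

theorem IsEigTrunc.rank_le (h : IsEigTrunc d M E) : E.rank ≤ d := by
  obtain ⟨u, lam, -, -, -, rfl⟩ := h
  have hterm : ∀ j : Fin p, (if (j : ℕ) < d then
      lam j • Matrix.vecMulVec (fun a => u j a) (fun a => u j a) else 0).rank ≤
      if (j : ℕ) < d then 1 else 0 := by
    intro j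
    split_ifs
    · exact (matrixRank_smul_le _ _).trans (Matrix.rank_vecMulVec_le _ _)
    · exact Matrix.rank_zero.le
  refine (matrixRank_sum_le _ _).trans ((Finset.sum_le_sum fun j _ => hterm j).trans ?_)
  rw [← Finset.card_filter]
  calc _ = ((Finset.univ.filter fun j : Fin p => (j : ℕ) < d).map Fin.valEmbedding).card :=
        (Finset.card_map _).symm
    _ ≤ (Finset.range d).card := Finset.card_le_card fun a ha => by
        obtain ⟨j, hj, rfl⟩ := Finset.mem_map.1 ha
        exact Finset.mem_range.2 (Finset.mem_filter.1 hj).2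
    _ = d := Finset.card_range d

/-- Dimension count: the constraints `Q x = 0` and `u i ⬝ᵥ x = 0` for `i > j` are at most
`d + (p - 1 - j) < p` many. -/
theorem exists_mulVec_eq_zero_of_rank_le (hQ : Q.rank ≤ d) (u : Fin p → Fin p → ℝ) {j : Fin p}
    (hj : d ≤ j) :
    ∃ x : Fin p → ℝ, x ≠ 0 ∧ Q *ᵥ x = 0 ∧ ∀ i, j < i → u i ⬝ᵥ x = 0 := by
  let L : (Fin p → ℝ) →ₗ[ℝ] LinearMap.range Q.mulVecLin × (Set.Ioi j → ℝ) :=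
    Q.mulVecLin.rangeRestrict.prod (Matrix.of fun i : Set.Ioi j => u i).mulVecLin
  have hdim : Module.finrank ℝ (LinearMap.range Q.mulVecLin × (Set.Ioi j → ℝ)) <
      Module.finrank ℝ (Fin p → ℝ) := by
    have hcard : Fintype.card (Set.Ioi j) = p - 1 - j := by
      rw [← Set.toFinset_card, Set.toFinset_Ioi, Fin.card_Ioi]
    rw [Module.finrank_prod, Module.finrank_fintype_fun_eq_card, Module.finrank_fin_fun,
      ← Matrix.rank, hcard]
    omega
  obtain ⟨x, hx, hx₀⟩ := Submodule.exists_mem_ne_zero_of_ne_bot (L.ker_ne_bot_of_finrank_lt hdim)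
  obtain ⟨hQx, hux⟩ := Prod.mk.inj (LinearMap.mem_ker.1 hx)
  exact ⟨x, hx₀, congrArg Subtype.val hQx, fun i hi => congrFun hux ⟨i, hi⟩⟩

/-- Weyl's inequality for a perturbation of a matrix of rank at most `d`. -/
theorem eigenvalue_le_of_rank_le (hu : Orthonormal ℝ u) (hlam : Antitone lam)
    (hQ : Q.rank ≤ d) {e : ℝ}
    (he : NumericalRadiusLE
      (∑ j, lam j • Matrix.vecMulVec (u j).ofLp (u j).ofLp - Q) e) {j : Fin p} (hj : d ≤ j) :
    lam j ≤ e := by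
  obtain ⟨x, hx, hQx, hux⟩ := exists_mulVec_eq_zero_of_rank_le hQ (fun i => (u i).ofLp) hj
  have hpos : 0 < x ⬝ᵥ x :=
    (dotProduct_self_nonneg x).lt_of_ne' (mt dotProduct_self_eq_zero.1 hx)
  have hquad := (le_abs_self _).trans (he x)
  rw [Matrix.sub_mulVec, hQx, sub_zero, dotProduct_sum_vecMulVec_mulVec] at hquad
  refine le_of_mul_le_mul_right (le_trans ?_ hquad) hpos
  rw [← sum_dotProduct_sq hu, Finset.mul_sum]
  refine Finset.sum_le_sum fun i _ => ?_
  rcases le_or_gt i j with hij | hij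
  · exact mul_le_mul_of_nonneg_right (hlam hij) (sq_nonneg _)
  · rw [hux i hij, sq, mul_zero, mul_zero, mul_zero]

theorem neg_le_eigenvalue_of_posSemidef (hu : Orthonormal ℝ u) (hQ : Q.PosSemidef) {e : ℝ}
    (he : NumericalRadiusLE (∑ j, lam j • Matrix.vecMulVec (u j).ofLp (u j).ofLp - Q) e)
    (j : Fin p) : -e ≤ lam j := by
  have hortho : ∀ i, (u i).ofLp ⬝ᵥ (u j).ofLp = if i = j then 1 else 0 := fun i => by
    rw [← inner_eq_dotProduct, orthonormal_iff_ite.1 hu]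
  have hquad := neg_le_of_abs_le (he (u j).ofLp)
  rw [Matrix.sub_mulVec, dotProduct_sub, dotProduct_sum_vecMulVec_mulVec] at hquad
  simp only [hortho, ite_pow, one_pow, ne_eq, OfNat.ofNat_ne_zero, not_false_eq_true, zero_pow,
    mul_ite, mul_one, mul_zero, Finset.sum_ite_eq', Finset.mem_univ, if_true] at hquad
  have hQj : 0 ≤ (u j).ofLp ⬝ᵥ Q *ᵥ (u j).ofLp := by
    simpa using hQ.dotProduct_mulVec_nonneg (u j).ofLp
  linarith

theorem IsEigTrunc.numericalRadiusLE_sub (h : IsEigTrunc d M E) (hQ : Q.PosSemidef)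
    (hQd : Q.rank ≤ d) {e : ℝ} (he₀ : 0 ≤ e) (he : NumericalRadiusLE (M - Q) e) :
    NumericalRadiusLE (E - M) e := by
  obtain ⟨u, lam, hu, hlam, rfl, rfl⟩ := h
  intro x
  have hsub : (∑ j : Fin p, if (j : ℕ) < d then
      lam j • Matrix.vecMulVec (u j).ofLp (u j).ofLp else 0) -
        ∑ j, lam j • Matrix.vecMulVec (u j).ofLp (u j).ofLp =
      ∑ j : Fin p, (if (j : ℕ) < d then 0 else -lam j) •
        Matrix.vecMulVec (u j).ofLp (u j).ofLp := by
    rw [← Finset.sum_sub_distrib]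
    refine Finset.sum_congr rfl fun j _ => ?_
    split_ifs <;> simp
  rw [hsub, dotProduct_sum_vecMulVec_mulVec, ← sum_dotProduct_sq hu, Finset.mul_sum]
  refine (Finset.abs_sum_le_sum_abs _ _).trans (Finset.sum_le_sum fun j _ => ?_)
  rw [abs_mul, abs_of_nonneg (sq_nonneg (_ : ℝ))]
  refine mul_le_mul_of_nonneg_right ?_ (sq_nonneg _)
  split_ifs with hj
  · rwa [abs_zero]
  · rw [abs_neg, abs_le]
    exact ⟨neg_le_eigenvalue_of_posSemidef hu hQ he j,
      eigenvalue_le_of_rank_le hu hlam hQd he (not_lt.1 hj)⟩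

theorem IsEigTrunc.frob_sub_le (h : IsEigTrunc d M E) (hQ : Q.PosSemidef) (hQd : Q.rank ≤ d)
    {e : ℝ} (he₀ : 0 ≤ e) (he : NumericalRadiusLE (M - Q) e) :
    frob (E - Q) ≤ √(2 * d) * (2 * e) := by
  have hrank : (E - Q).rank ≤ 2 * d :=
    (matrixRank_sub_le _ _).trans (by linarith [h.rank_le])
  have hrad : NumericalRadiusLE (E - Q) (2 * e) := by
    have := (h.numericalRadiusLE_sub hQ hQd he₀ he).add he
    rwa [sub_add_sub_cancel, ← two_mul] at this
  calc frob (E - Q) = √(∑ a, ∑ b, (E - Q) a b ^ 2) := frob_eq_sqrt _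
    _ ≤ √((2 * d : ℕ) * (2 * e) ^ 2) := Real.sqrt_le_sqrt
        (hrad.sum_sq_le (h.isHermitian.sub hQ.1) (by positivity) hrank)
    _ = √(2 * d) * (2 * e) := by
        rw [Real.sqrt_mul (by positivity), Real.sqrt_sq (by positivity)]
        push_cast
        rfl

end Truncation

/-! ### Contractions of operators with rank-one tensors of matrices -/

section Contraction

variable {r : ℕ} {n m : Fin r → ℕ}

theorem prod_update {β : Fin r → Type*} (g : (l : Fin r) → β l → ℝ) (B : (l : Fin r) → β l)
    (k : Fin r) (c : β k) :
    ∏ l, g l (Function.update B k c l) = g k c * ∏ l ∈ Finset.univ.erase k, g l (B l) := by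
  rw [← Finset.mul_prod_erase _ _ (Finset.mem_univ k), Function.update_self]
  congr 1
  refine Finset.prod_congr rfl fun l hl => ?_
  rw [Function.update_of_ne (Finset.ne_of_mem_erase hl)]

theorem signalHat_add (S S' : Op n n) (C : (k : Fin r) → Matrix (Fin (n k)) (Fin (n k)) ℝ) :
    signalHat (S + S') C = signalHat S C + signalHat S' C := by
  simp only [signalHat, pair, Matrix.add_apply, mul_add, Finset.sum_add_distrib]

theorem signalHat_tucker (G C : (k : Fin r) → Matrix (Fin (n k)) (Fin (n k)) ℝ) :
    signalHat (tucker G) C = ∏ k, inner ℝ (vec (C k)) (vec (G k)) := by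
  simp only [inner_vec, ← Fintype.sum_prod_type', Finset.prod_univ_sum, Fintype.piFinset_univ,
    signalHat, pair, tucker, Matrix.of_apply, Finset.prod_mul_distrib]

theorem signalHat_sum_smul (S : Op n n) (c : (k : Fin r) → Fin (n k) → ℝ)
    (V : (k : Fin r) → Fin (n k) → Matrix (Fin (n k)) (Fin (n k)) ℝ) :
    signalHat S (fun k => ∑ j, c k j • V k j) =
      ∑ J : Idx n, (∏ k, c k (J k)) * signalHat S fun k => V k (J k) := by
  simp only [signalHat, Finset.mul_sum]
  rw [Finset.sum_comm]
  refine Finset.sum_congr rfl fun p _ => ?_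
  simp only [Matrix.sum_apply, Matrix.smul_apply, smul_eq_mul, Finset.prod_univ_sum,
    Fintype.piFinset_univ, Finset.sum_mul, Finset.prod_mul_distrib, mul_assoc]

theorem signalHat_vecMulVec (F : Op n n) (u v : (k : Fin r) → EuclideanSpace ℝ (Fin (n k))) :
    signalHat F (fun k => Matrix.vecMulVec (v k).ofLp (u k).ofLp) =
      inner ℝ (Matrix.toEuclideanLin F (rankOne u)) (rankOne v) := by
  rw [signalHat, ← (Equiv.arrowProdEquivProdArrow (Fin r) (fun k => Fin (n k))
    (fun k => Fin (n k))).symm.sum_comp, Fintype.sum_prod_type, PiLp.inner_apply]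
  refine Finset.sum_congr rfl fun i _ => ?_
  simp only [Matrix.toLpLin_apply, Matrix.mulVec, dotProduct, rankOne, pair,
    Matrix.vecMulVec_apply, Finset.prod_mul_distrib, RCLike.inner_apply, conj_trivial,
    Finset.mul_sum, Equiv.arrowProdEquivProdArrow, Equiv.coe_fn_symm_mk]
  exact Finset.sum_congr rfl fun j _ => by ring

theorem trace_tucker (G : (k : Fin r) → Matrix (Fin (n k)) (Fin (n k)) ℝ) :
    (tucker G).trace = ∏ k, (G k).trace := by
  simp only [Matrix.trace, Finset.prod_univ_sum, Fintype.piFinset_univ]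
  rfl

theorem tucker_mul_transpose (A : (k : Fin r) → Matrix (Fin (n k)) (Fin (m k)) ℝ) :
    tucker A * (tucker A)ᵀ = tucker (gram A) := by
  ext i j
  simp only [Matrix.mul_apply, tucker, Matrix.of_apply, Matrix.transpose_apply, gram,
    Finset.prod_univ_sum, Fintype.piFinset_univ, Finset.prod_mul_distrib]

theorem sum_mul_powerUpdate (S : Op n n) (B : (k : Fin r) → Matrix (Fin (n k)) (Fin (n k)) ℝ)
    (k : Fin r) (c : Matrix (Fin (n k)) (Fin (n k)) ℝ) :
    ∑ a, ∑ b, c a b * powerUpdate S B k a b = signalHat S (Function.update B k c) := by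
  simp only [powerUpdate, Matrix.of_apply, Finset.mul_sum, mul_ite, mul_zero]
  rw [← Fintype.sum_prod_type' (f := fun a b => ∑ p : (l : Fin r) → Fin (n l) × Fin (n l),
    if p k = (a, b) then c a b * ((∏ l ∈ Finset.univ.erase k, B l (p l).1 (p l).2) * pair S p)
      else 0), Finset.sum_comm]
  refine Finset.sum_congr rfl fun p _ => ?_
  rw [prod_update (fun l (M : Matrix (Fin (n l)) (Fin (n l)) ℝ) => M (p l).1 (p l).2) B k c,
    Finset.sum_ite_eq, if_pos (Finset.mem_univ _), mul_assoc]

theorem dotProduct_powerUpdate_mulVec (S : Op n n)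
    (B : (k : Fin r) → Matrix (Fin (n k)) (Fin (n k)) ℝ) (k : Fin r) (x : Fin (n k) → ℝ) :
    x ⬝ᵥ (powerUpdate S B k *ᵥ x) =
      signalHat S (Function.update B k (Matrix.vecMulVec x x)) := by
  rw [← sum_mul_powerUpdate]
  simp only [dotProduct, Matrix.mulVec, Finset.mul_sum, Matrix.vecMulVec_apply]
  exact Finset.sum_congr rfl fun a _ => Finset.sum_congr rfl fun b _ => by ring

theorem powerUpdate_apply (S : Op n n) (B : (k : Fin r) → Matrix (Fin (n k)) (Fin (n k)) ℝ)
    (k : Fin r) (a b : Fin (n k)) :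
    powerUpdate S B k a b = signalHat S (Function.update B k (Matrix.single a b 1)) := by
  rw [← sum_mul_powerUpdate]
  simp [Matrix.single_apply, ite_and]

theorem powerUpdate_add (S S' : Op n n) (B : (k : Fin r) → Matrix (Fin (n k)) (Fin (n k)) ℝ)
    (k : Fin r) : powerUpdate (S + S') B k = powerUpdate S B k + powerUpdate S' B k := by
  ext a b
  simp only [Matrix.add_apply, powerUpdate_apply, signalHat_add]

theorem powerUpdate_tucker (G B : (k : Fin r) → Matrix (Fin (n k)) (Fin (n k)) ℝ) (k : Fin r) :
    powerUpdate (tucker G) B k =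
      (∏ l ∈ Finset.univ.erase k, (inner ℝ (vec (B l)) (vec (G l)) : ℝ)) • G k := by
  ext a b
  rw [powerUpdate_apply, signalHat_tucker,
    prod_update (fun l (M : Matrix (Fin (n l)) (Fin (n l)) ℝ) =>
      (inner ℝ (vec M) (vec (G l)) : ℝ)) B k, inner_vec, Matrix.smul_apply, smul_eq_mul, mul_comm]
  simp [Matrix.single_apply, ite_and]

end Contraction

/-! ### The multilinear spectral norm -/

section MlNorm

variable {r : ℕ} {n m : Fin r → ℕ}

theorem norm_rankOne (v : (k : Fin r) → EuclideanSpace ℝ (Fin (n k))) :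
    ‖rankOne v‖ = ∏ k, ‖v k‖ := by
  rw [← sq_eq_sq₀ (norm_nonneg _) (Finset.prod_nonneg fun _ _ => norm_nonneg _),
    ← Finset.prod_pow]
  simp only [EuclideanSpace.real_norm_sq_eq, Finset.prod_univ_sum, Fintype.piFinset_univ, rankOne,
    Finset.prod_pow]

theorem norm_rankOne_le_one {v : (k : Fin r) → EuclideanSpace ℝ (Fin (n k))}
    (hv : ∀ k, ‖v k‖ ≤ 1) : ‖rankOne v‖ ≤ 1 := by
  rw [norm_rankOne]
  exact Finset.prod_le_one (fun _ _ => norm_nonneg _) fun k _ => hv k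

theorem inner_toEuclideanLin_rankOne_le (F : Op m n)
    {u : (k : Fin r) → EuclideanSpace ℝ (Fin (m k))}
    {v : (k : Fin r) → EuclideanSpace ℝ (Fin (n k))} (hu : ∀ k, ‖u k‖ ≤ 1) (hv : ∀ k, ‖v k‖ ≤ 1) :
    inner ℝ (Matrix.toEuclideanLin F (rankOne u)) (rankOne v) ≤ mlNorm F := by
  refine le_csSup ⟨opNorm F, ?_⟩ ⟨u, v, hu, hv, rfl⟩
  rintro x ⟨u, v, hu, hv, rfl⟩
  calc inner ℝ (Matrix.toEuclideanLin F (rankOne u)) (rankOne v)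
      ≤ ‖Matrix.toEuclideanLin F (rankOne u)‖ * ‖rankOne v‖ := real_inner_le_norm _ _
    _ ≤ ‖Matrix.toEuclideanLin F (rankOne u)‖ :=
        mul_le_of_le_one_right (norm_nonneg _) (norm_rankOne_le_one hv)
    _ ≤ opNorm F := (Matrix.toEuclideanLin F).toContinuousLinearMap.unit_le_opNorm _
        (norm_rankOne_le_one hu)

theorem rankOne_update_neg (v : (k : Fin r) → EuclideanSpace ℝ (Fin (n k))) (k : Fin r) :
    rankOne (Function.update v k (-v k)) = -rankOne v := by
  ext i
  simp only [rankOne, PiLp.neg_apply]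
  rw [prod_update (fun l (w : EuclideanSpace ℝ (Fin (n l))) => w (i l)) v k,
    ← Finset.mul_prod_erase _ _ (Finset.mem_univ k), PiLp.neg_apply, neg_mul]

theorem abs_inner_toEuclideanLin_rankOne_le (hr : 0 < r) (F : Op m n)
    {u : (k : Fin r) → EuclideanSpace ℝ (Fin (m k))}
    {v : (k : Fin r) → EuclideanSpace ℝ (Fin (n k))} (hu : ∀ k, ‖u k‖ ≤ 1) (hv : ∀ k, ‖v k‖ ≤ 1) :
    |inner ℝ (Matrix.toEuclideanLin F (rankOne u)) (rankOne v)| ≤ mlNorm F := by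
  refine abs_le'.2 ⟨inner_toEuclideanLin_rankOne_le F hu hv, ?_⟩
  rw [← inner_neg_right, ← rankOne_update_neg v ⟨0, hr⟩]
  refine inner_toEuclideanLin_rankOne_le F hu fun k => ?_
  rcases eq_or_ne k ⟨0, hr⟩ with rfl | hk
  · simpa using hv _
  · rw [Function.update_of_ne hk]
    exact hv k

theorem mlNorm_nonneg (hr : 0 < r) (F : Op m n) : 0 ≤ mlNorm F :=
  (abs_nonneg _).trans
    (abs_inner_toEuclideanLin_rankOne_le hr F (u := 0) (v := 0) (by simp) (by simp))

theorem abs_signalHat_le_mlNorm_mul_prod_sum (hr : 0 < r) (F : Op n n)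
    {C : (k : Fin r) → Matrix (Fin (n k)) (Fin (n k)) ℝ} (hC : ∀ k, (C k).IsHermitian) :
    |signalHat F C| ≤ mlNorm F * ∏ k, ∑ j, |(hC k).eigenvalues j| := by
  have hexp : signalHat F C = ∑ J : Idx n, (∏ k, (hC k).eigenvalues (J k)) *
      signalHat F fun k => Matrix.vecMulVec ((hC k).eigenvectorBasis (J k)).ofLp
        ((hC k).eigenvectorBasis (J k)).ofLp :=
    (congrArg _ (funext fun k => eq_sum_eigenvalues_smul_vecMulVec (hC k))).trans
      (signalHat_sum_smul F _ _)
  rw [hexp, Finset.prod_univ_sum, Fintype.piFinset_univ, Finset.mul_sum]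
  refine (Finset.abs_sum_le_sum_abs _ _).trans (Finset.sum_le_sum fun J _ => ?_)
  rw [abs_mul, Finset.abs_prod, mul_comm, signalHat_vecMulVec]
  refine mul_le_mul_of_nonneg_right ?_ (Finset.prod_nonneg fun _ _ => abs_nonneg _)
  exact abs_inner_toEuclideanLin_rankOne_le hr F (by simp) (by simp)

theorem abs_signalHat_le (hr : 0 < r) (F : Op n n)
    {C : (k : Fin r) → Matrix (Fin (n k)) (Fin (n k)) ℝ} (hC : ∀ k, (C k).IsHermitian)
    {d : Fin r → ℕ} (hd : ∀ k, (C k).rank ≤ d k) :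
    |signalHat F C| ≤ mlNorm F * ∏ k, (√(d k) * frob (C k)) := by
  refine (abs_signalHat_le_mlNorm_mul_prod_sum hr F hC).trans
    (mul_le_mul_of_nonneg_left ?_ (mlNorm_nonneg hr F))
  refine Finset.prod_le_prod (fun k _ => Finset.sum_nonneg fun _ _ => abs_nonneg _) fun k _ => ?_
  rw [frob_eq_sqrt]
  exact sum_abs_eigenvalues_le (hC k) (hd k)

end MlNorm

/-! ### One power iteration -/

section Step

variable {r : ℕ} {n m : Fin r → ℕ} {A : (k : Fin r) → Matrix (Fin (n k)) (Fin (m k)) ℝ}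
  {B B' : (k : Fin r) → Matrix (Fin (n k)) (Fin (n k)) ℝ} {F : Op n n}

theorem numericalRadiusLE_powerUpdate (hr : 0 < r) (F : Op n n) (hB : IsFeasible m B)
    (k : Fin r) :
    NumericalRadiusLE (powerUpdate F B k) (mlNorm F * ∏ l ∈ Finset.univ.erase k, √(m l)) := by
  intro x
  have hherm : ∀ l, (Function.update B k (Matrix.vecMulVec x x) l).IsHermitian :=
    (Function.forall_update_iff B fun l M => M.IsHermitian).2
      ⟨isHermitian_vecMulVec_self x, fun l _ => (hB l).1.1⟩
  have hrank : ∀ l, (Function.update B k (Matrix.vecMulVec x x) l).rank ≤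
      Function.update m k 1 l := by
    intro l
    rcases eq_or_ne l k with rfl | hl
    · simpa only [Function.update_self] using Matrix.rank_vecMulVec_le x x
    · simpa only [Function.update_of_ne hl] using (hB l).2.1
  have hprod : ∏ l, (√(Function.update m k 1 l) *
      frob (Function.update B k (Matrix.vecMulVec x x) l)) =
        (∏ l ∈ Finset.univ.erase k, √(m l)) * (x ⬝ᵥ x) := by
    rw [Finset.prod_mul_distrib, prod_update (fun _ (d : ℕ) => √d),
      prod_update (fun _ M => frob M), frob_vecMulVec_self,
      Finset.prod_congr rfl fun l _ => (hB l).2.2, Finset.prod_const_one]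
    simp only [Nat.cast_one, Real.sqrt_one, one_mul, mul_one]
  rw [dotProduct_powerUpdate_mulVec, mul_assoc, ← hprod]
  exact abs_signalHat_le hr F hherm hrank

theorem frob_eigTrunc_powerUpdate_sub_le (hr : 0 < r)
    {G : (k : Fin r) → Matrix (Fin (n k)) (Fin (n k)) ℝ} {k : Fin r} (hG : (G k).PosSemidef)
    (hGm : (G k).rank ≤ m k) (hB : IsFeasible m B)
    (hc : 0 ≤ ∏ l ∈ Finset.univ.erase k, (inner ℝ (vec (B l)) (vec (G l)) : ℝ))
    {E : Matrix (Fin (n k)) (Fin (n k)) ℝ}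
    (hE : IsEigTrunc (m k) (powerUpdate (tucker G + F) B k) E) :
    frob (E - (∏ l ∈ Finset.univ.erase k, (inner ℝ (vec (B l)) (vec (G l)) : ℝ)) • G k) ≤
      2 * √2 * (√(∏ l, (m l : ℝ)) * mlNorm F) := by
  have hrad := numericalRadiusLE_powerUpdate hr F hB k
  have hsqrt : √(∏ l, (m l : ℝ)) = √(m k) * ∏ l ∈ Finset.univ.erase k, √(m l) := by
    rw [Real.sqrt_prod _ fun _ _ => Nat.cast_nonneg _,
      Finset.mul_prod_erase _ (fun l => √(m l)) (Finset.mem_univ k)]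
  calc _ ≤ √(2 * m k) * (2 * (mlNorm F * ∏ l ∈ Finset.univ.erase k, √(m l))) := by
        refine hE.frob_sub_le (hG.smul hc) ((matrixRank_smul_le _ _).trans hGm)
          (mul_nonneg (mlNorm_nonneg hr F) (Finset.prod_nonneg fun _ _ => Real.sqrt_nonneg _)) ?_
        rwa [powerUpdate_add, powerUpdate_tucker, add_sub_cancel_left]
    _ = 2 * √2 * (√(∏ l, (m l : ℝ)) * mlNorm F) := by
        rw [hsqrt, Real.sqrt_mul (by norm_num)]
        ring

theorem gram_posSemidef (A : (k : Fin r) → Matrix (Fin (n k)) (Fin (m k)) ℝ) (k : Fin r) :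
    (gram A k).PosSemidef := by
  simpa [gram] using Matrix.posSemidef_self_mul_conjTranspose (A k)

theorem rank_gram_le (A : (k : Fin r) → Matrix (Fin (n k)) (Fin (m k)) ℝ) (k : Fin r) :
    (gram A k).rank ≤ m k :=
  (Matrix.rank_mul_le_left _ _).trans (by simpa using Matrix.rank_le_card_width (A k))

theorem inner_vec_gram_nonneg (A : (k : Fin r) → Matrix (Fin (n k)) (Fin (m k)) ℝ) {k : Fin r}
    {M : Matrix (Fin (n k)) (Fin (n k)) ℝ} (hM : M.PosSemidef) :
    0 ≤ (inner ℝ (vec M) (vec (gram A k)) : ℝ) := by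
  refine (hM.conjTranspose_mul_mul_same (A k)).trace_nonneg.trans_eq ?_
  rw [inner_vec, Matrix.mul_assoc, Matrix.trace_mul_comm, Matrix.mul_assoc]
  simp only [Matrix.trace, Matrix.diag, Matrix.mul_apply (M := M)]
  refine Finset.sum_congr rfl fun a _ => Finset.sum_congr rfl fun b _ => ?_
  simp [gram, Matrix.mul_apply, mul_comm]

theorem frob_gram_mul_sqrt_le_inner {k : Fin r} {M : Matrix (Fin (n k)) (Fin (n k)) ℝ}
    (hM : M.PosSemidef) (hM₁ : frob M = 1) (hG : 0 < frob (gram A k)) {τ : ℝ}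
    (hsin : Real.sin (initAngle A k M) ≤ τ) :
    frob (gram A k) * √(1 - τ ^ 2) ≤ inner ℝ (vec M) (vec (gram A k)) := by
  have hcos : Real.cos (initAngle A k M) * frob (gram A k) =
      inner ℝ (vec M) (vec (gram A k)) := by
    rw [initAngle, InnerProductGeometry.angle_smul_left_of_pos _ _ (inv_pos.2 hG),
      InnerProductGeometry.cos_angle, show ‖vec M‖ = 1 from hM₁, mul_one, real_inner_comm]
    exact div_mul_cancel₀ _ hG.ne'
  have hcos₀ : 0 ≤ Real.cos (initAngle A k M) :=
    nonneg_of_mul_nonneg_left (hcos ▸ inner_vec_gram_nonneg A hM) hG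
  have hsin₀ : 0 ≤ Real.sin (initAngle A k M) := InnerProductGeometry.sin_angle_nonneg _ _
  rw [← hcos, mul_comm]
  refine mul_le_mul_of_nonneg_right ((Real.sqrt_le_left hcos₀).2 ?_) hG.le
  linarith [Real.sin_sq_add_cos_sq (initAngle A k M), pow_le_pow_left₀ hsin₀ hsin 2]

theorem signal_mul_pow_le_prod_inner_mul_frob (hG : ∀ k, 0 < frob (gram A k)) {τ : ℝ}
    (hB : IsFeasible m B) (hsin : ∀ k, Real.sin (initAngle A k (B k)) ≤ τ) (k : Fin r) :
    signal A * √(1 - τ ^ 2) ^ (r - 1) ≤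
      (∏ l ∈ Finset.univ.erase k, (inner ℝ (vec (B l)) (vec (gram A l)) : ℝ)) *
        frob (gram A k) := by
  calc signal A * √(1 - τ ^ 2) ^ (r - 1)
      = (∏ l ∈ Finset.univ.erase k, (frob (gram A l) * √(1 - τ ^ 2))) * frob (gram A k) := by
        rw [Finset.prod_mul_distrib, Finset.prod_const,
          Finset.card_erase_of_mem (Finset.mem_univ k), Finset.card_univ, Fintype.card_fin, signal,
          ← Finset.mul_prod_erase _ _ (Finset.mem_univ k)]
        ring
    _ ≤ _ := by
        refine mul_le_mul_of_nonneg_right (Finset.prod_le_prod (fun l _ => ?_) fun l _ => ?_)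
          (hG k).le
        · exact mul_nonneg (hG l).le (Real.sqrt_nonneg _)
        · exact frob_gram_mul_sqrt_le_inner (hB l).1 (hB l).2.2 (hG l) (hsin l)

/-- The normalized signal direction `b_k = vec(B_k) / ‖B_k‖_F` in mode `k`; it is `0` when
`B_k = 0`. -/
noncomputable def unitGram (A : (k : Fin r) → Matrix (Fin (n k)) (Fin (m k)) ℝ) (k : Fin r) :
    EuclideanSpace ℝ (Fin (n k) × Fin (n k)) :=
  (frob (gram A k))⁻¹ • vec (gram A k)

theorem norm_unitGram {k : Fin r} (hG : 0 < frob (gram A k)) : ‖unitGram A k‖ = 1 :=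
  frob_inv_frob_smul hG.ne'

theorem frob_smul_unitGram {k : Fin r} (hG : 0 < frob (gram A k)) :
    frob (gram A k) • unitGram A k = vec (gram A k) :=
  smul_inv_smul₀ hG.ne' _

/-- The matrices `B_k` are symmetric, of rank at most `m_k` and of unit Frobenius norm, and make
an angle with sine at most `s` with the signal direction in every mode. -/
structure IsAligned (A : (k : Fin r) → Matrix (Fin (n k)) (Fin (m k)) ℝ) (s : ℝ)
    (B : (k : Fin r) → Matrix (Fin (n k)) (Fin (n k)) ℝ) : Prop where
  frob_eq_one : ∀ k, frob (B k) = 1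
  isHermitian : ∀ k, (B k).IsHermitian
  rank_le : ∀ k, (B k).rank ≤ m k
  sqrt_le_inner : ∀ k, √(1 - s ^ 2) ≤ inner ℝ (vec (B k)) (unitGram A k)

/-- Up to scaling, the truncated update is a perturbation of the signal direction, whose relative
size is at most `s`. -/
theorem IsIteration.isAligned (hr : 0 < r) (hG : ∀ k, 0 < frob (gram A k)) {τ s : ℝ}
    (hτ : 0 < 1 - τ ^ 2) (hs₀ : 0 ≤ s) (hs₁ : s < 1)
    (hs : 2 * √2 * (√(∏ l, (m l : ℝ)) * mlNorm F) ≤ signal A * √(1 - τ ^ 2) ^ (r - 1) * s)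
    (hB : IsFeasible m B) (hsin : ∀ k, Real.sin (initAngle A k (B k)) ≤ τ)
    (hit : IsIteration m (tucker (gram A) + F) B B') : IsAligned A s B' := by
  suffices h : ∀ k, frob (B' k) = 1 ∧ (B' k).IsHermitian ∧ (B' k).rank ≤ m k ∧
      √(1 - s ^ 2) ≤ inner ℝ (vec (B' k)) (unitGram A k) from
    ⟨fun k => (h k).1, fun k => (h k).2.1, fun k => (h k).2.2.1, fun k => (h k).2.2.2⟩
  intro k
  obtain ⟨E, hE, hB'⟩ := hit k
  rw [hB']
  set c := ∏ l ∈ Finset.univ.erase k, (inner ℝ (vec (B l)) (vec (gram A l)) : ℝ)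
  have hc : signal A * √(1 - τ ^ 2) ^ (r - 1) ≤ c * frob (gram A k) :=
    signal_mul_pow_le_prod_inner_mul_frob hG hB hsin k
  have hcG : 0 < c * frob (gram A k) :=
    (mul_pos (Finset.prod_pos fun l _ => hG l) (pow_pos (Real.sqrt_pos.2 hτ) _)).trans_le hc
  have hpert : ‖vec E - (c * frob (gram A k)) • unitGram A k‖ ≤ (c * frob (gram A k)) * s := by
    rw [mul_smul, frob_smul_unitGram (hG k), ← vec_smul, ← vec_sub]
    exact (frob_eigTrunc_powerUpdate_sub_le hr (gram_posSemidef A k) (rank_gram_le A k) hB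
      (pos_of_mul_pos_left hcG (hG k).le).le hE).trans
      (hs.trans (mul_le_mul_of_nonneg_right hc hs₀))
  obtain ⟨hE₀, hinner⟩ := sqrt_le_inner_of_norm_sub_le (norm_unitGram (hG k)) hcG hs₀ hs₁ hpert
  exact ⟨frob_inv_frob_smul (norm_ne_zero_iff.2 hE₀),
    hE.isHermitian.smul (IsSelfAdjoint.all _),
    (matrixRank_smul_le _ _).trans hE.rank_le, hinner⟩

end Step

/-! ### The thresholds `τ₁`, `f₁` and `f₂` -/

section Thresholds

variable {r : ℕ} {M ρ τ : ℝ}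

theorem exists_gFun_pos_of_lt_tauOne (hτ₀ : 0 ≤ τ) (hτ : τ < tauOne r M ρ) :
    ∃ x, τ < x ∧ x < 1 ∧ 0 < gFun r M ρ x := by
  have hne : {x : ℝ | 0 < x ∧ x < 1 ∧ 0 < gFun r M ρ x}.Nonempty := by
    by_contra hne
    rw [tauOne, Set.not_nonempty_iff_eq_empty.1 hne, Real.sSup_empty] at hτ
    exact hτ₀.not_gt hτ
  obtain ⟨x, ⟨-, hx₁, hgx⟩, hx⟩ := exists_lt_of_lt_csSup hne hτ
  exact ⟨x, hx, hx₁, hgx⟩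

theorem one_sub_sq_pos_of_lt_tauOne (hτ₀ : 0 ≤ τ) (hτ : τ < tauOne r M ρ) : 0 < 1 - τ ^ 2 := by
  obtain ⟨x, hx, hx₁, -⟩ := exists_gFun_pos_of_lt_tauOne hτ₀ hτ
  exact sub_pos.2 (pow_lt_one₀ hτ₀ (hx.trans hx₁) two_ne_zero)

theorem sqrt_pow_mul_f₁ (hr : 0 < r) (hτ : 0 < 1 - τ ^ 2) :
    √(1 - τ ^ 2) ^ (r - 1) * f₁ r M ρ τ = 4 * √(2 * M) * ρ := by
  have hpow : (1 - τ ^ 2) ^ (((r : ℝ) - 1) / 2) = √(1 - τ ^ 2) ^ (r - 1) := by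
    rw [Real.sqrt_eq_rpow, ← Real.rpow_natCast _ (r - 1), ← Real.rpow_mul hτ.le, Nat.cast_pred hr]
    ring_nf
  have hne : √(1 - τ ^ 2) ^ (r - 1) ≠ 0 := (pow_pos (Real.sqrt_pos.2 hτ) _).ne'
  rw [f₁, hpow]
  field_simp

theorem f₁_nonneg (hρ : 0 ≤ ρ) (hτ : 0 ≤ 1 - τ ^ 2) : 0 ≤ f₁ r M ρ τ :=
  mul_nonneg hρ (div_nonneg (by positivity) (Real.rpow_nonneg hτ _))

theorem pow_mul_f₁_sq (hr : 0 < r) (hM : 0 ≤ M) (hτ : 0 < 1 - τ ^ 2) :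
    (1 - τ ^ 2) ^ (r - 1) * f₁ r M ρ τ ^ 2 = 32 * M * ρ ^ 2 := by
  calc (1 - τ ^ 2) ^ (r - 1) * f₁ r M ρ τ ^ 2
      = (√(1 - τ ^ 2) ^ (r - 1) * f₁ r M ρ τ) ^ 2 := by
        rw [mul_pow, pow_right_comm, Real.sq_sqrt hτ.le]
    _ = 32 * M * ρ ^ 2 := by
        rw [sqrt_pow_mul_f₁ hr hτ, mul_pow, mul_pow, Real.sq_sqrt (by positivity)]
        ring

theorem f₂_eq (hr : 0 < r) (hM : 0 ≤ M) (hτ : 0 < 1 - τ ^ 2) :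
    f₂ r M ρ τ = r / 2 * f₁ r M ρ τ ^ 2 + ρ * √M := by
  rw [f₂, eq_div_of_mul_eq (pow_pos hτ _).ne' ((mul_comm _ _).trans (pow_mul_f₁_sq hr hM hτ))]
  ring

theorem exists_f₁_sq_le (hr : 0 < r) (hM : 0 ≤ M) (hτ₀ : 0 ≤ τ) (hτ : τ < tauOne r M ρ) :
    ∃ x, 0 ≤ x ∧ x < 1 ∧ f₁ r M ρ τ ^ 2 ≤ x ^ 2 ∧
      32 * M * ρ ^ 2 ≤ x ^ 2 * (1 - x ^ 2) ^ (r - 1) := by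
  have hτ₁ := one_sub_sq_pos_of_lt_tauOne hτ₀ hτ
  obtain ⟨x, hx, hx₁, hgx⟩ := exists_gFun_pos_of_lt_tauOne hτ₀ hτ
  have hsmall : 32 * M * ρ ^ 2 ≤ x ^ 2 * (1 - x ^ 2) ^ (r - 1) := (sub_pos.1 hgx).le
  refine ⟨x, hτ₀.trans hx.le, hx₁, ?_, hsmall⟩
  have hpow : (1 - x ^ 2) ^ (r - 1) ≤ (1 - τ ^ 2) ^ (r - 1) :=
    pow_le_pow_left₀ (sub_nonneg.2 (pow_le_one₀ (hτ₀.trans hx.le) hx₁.le))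
      (sub_le_sub_left (pow_le_pow_left₀ hτ₀ hx.le 2) 1) _
  refine le_of_mul_le_mul_left ?_ (pow_pos hτ₁ (r - 1))
  rw [pow_mul_f₁_sq hr hM hτ₁, mul_comm _ (x ^ 2)]
  exact hsmall.trans (mul_le_mul_of_nonneg_left hpow (sq_nonneg x))

theorem f₁_lt_one (hr : 0 < r) (hM : 0 ≤ M) (hτ₀ : 0 ≤ τ) (hτ : τ < tauOne r M ρ) :
    f₁ r M ρ τ < 1 := by
  obtain ⟨x, hx₀, hx₁, hf, -⟩ := exists_f₁_sq_le hr hM hτ₀ hτ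
  exact (abs_le_of_sq_le_sq' hf hx₀).2.trans_lt hx₁

theorem sqrt_mul_le_sqrt_one_sub_f₁_sq_pow (hr : 0 < r) (hM : 0 ≤ M) (hτ₀ : 0 ≤ τ)
    (hτ : τ < tauOne r M ρ) : √M * ρ ≤ √(1 - (f₁ r M ρ τ / 2) ^ 2) ^ r := by
  obtain ⟨x, hx₀, hx₁, hf, hsmall⟩ := exists_f₁_sq_le hr hM hτ₀ hτ
  have hx_sq : x ^ 2 ≤ 1 := pow_le_one₀ hx₀ hx₁.le
  have hle : 1 - x ^ 2 ≤ 1 - (f₁ r M ρ τ / 2) ^ 2 := by linarith [sq_nonneg (f₁ r M ρ τ)]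
  have hquarter : 1 / 32 ≤ 1 - (f₁ r M ρ τ / 2) ^ 2 := by linarith
  refine abs_le_of_sq_le_sq' ?_ (by positivity) |>.2
  calc (√M * ρ) ^ 2 = 1 / 32 * (32 * M * ρ ^ 2) := by
        rw [mul_pow, Real.sq_sqrt hM]
        ring
    _ ≤ 1 / 32 * (1 - x ^ 2) ^ (r - 1) := by
        refine mul_le_mul_of_nonneg_left (hsmall.trans ?_) (by norm_num)
        exact mul_le_of_le_one_left (pow_nonneg (by linarith) _) hx_sq
    _ ≤ (1 - (f₁ r M ρ τ / 2) ^ 2) * (1 - (f₁ r M ρ τ / 2) ^ 2) ^ (r - 1) :=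
        mul_le_mul hquarter (pow_le_pow_left₀ (by linarith) hle _) (pow_nonneg (by linarith) _)
          (by linarith)
    _ = (√(1 - (f₁ r M ρ τ / 2) ^ 2) ^ r) ^ 2 := by
        rw [mul_pow_sub_one hr.ne', pow_right_comm, Real.sq_sqrt (by linarith)]

end Thresholds

/-! ### From alignment to the trace of the fitted signal -/

section Deterministic

variable {r : ℕ} {n m : Fin r → ℕ} {A : (k : Fin r) → Matrix (Fin (n k)) (Fin (m k)) ℝ} {s : ℝ}
  {B B' : (k : Fin r) → Matrix (Fin (n k)) (Fin (n k)) ℝ} {S F : Op n n}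

theorem frob_gram_pos (hsignal : 0 < signal A) (k : Fin r) : 0 < frob (gram A k) :=
  (frob_nonneg _).lt_of_ne' (Finset.prod_ne_zero_iff.1 hsignal.ne' k (Finset.mem_univ k))

theorem signal_eq_frob_gram_pow (hscale : ∀ k l, frob (gram A k) = frob (gram A l)) (k : Fin r) :
    signal A = frob (gram A k) ^ r := by
  rw [signal, Finset.prod_congr rfl fun l _ => hscale l k, Finset.prod_const, Finset.card_univ,
    Fintype.card_fin]

theorem signalHat_tucker_gram_add_div_signal (F : Op n n)
    (B : (k : Fin r) → Matrix (Fin (n k)) (Fin (n k)) ℝ) :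
    signalHat (tucker (gram A) + F) B / signal A =
      ∏ k, inner ℝ (vec (B k)) (unitGram A k) + signalHat F B / signal A := by
  rw [signalHat_add, add_div, signalHat_tucker, signal, ← Finset.prod_div_distrib]
  simp only [unitGram, inner_smul_right, inv_mul_eq_div]

theorem IsAligned.sqrt_pow_le_prod_inner (h : IsAligned A s B) :
    √(1 - s ^ 2) ^ r ≤ ∏ k, inner ℝ (vec (B k)) (unitGram A k) := by
  calc √(1 - s ^ 2) ^ r = ∏ _k : Fin r, √(1 - s ^ 2) := by simp
    _ ≤ _ := Finset.prod_le_prod (fun _ _ => Real.sqrt_nonneg _) fun k _ => h.sqrt_le_inner k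

theorem IsAligned.prod_inner_le_one (h : IsAligned A s B) (hG : ∀ k, 0 < frob (gram A k)) :
    ∏ k, inner ℝ (vec (B k)) (unitGram A k) ≤ 1 := by
  refine Finset.prod_le_one (fun k _ => (Real.sqrt_nonneg _).trans (h.sqrt_le_inner k))
    fun k _ => ?_
  refine (real_inner_le_norm _ _).trans_eq ?_
  rw [norm_unitGram (hG k), mul_one]
  exact h.frob_eq_one k

theorem IsAligned.abs_signalHat_div_signal_le (hr : 0 < r) (h : IsAligned A s B)
    (hsignal : 0 < signal A) {ρ : ℝ} (hF : mlNorm F ≤ ρ * signal A) :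
    |signalHat F B / signal A| ≤ √(∏ k, (m k : ℝ)) * ρ := by
  rw [abs_div, abs_of_pos hsignal, div_le_iff₀ hsignal, mul_assoc, mul_comm]
  calc |signalHat F B| ≤ mlNorm F * ∏ k, (√(m k) * frob (B k)) :=
        abs_signalHat_le hr F h.isHermitian h.rank_le
    _ = mlNorm F * √(∏ k, (m k : ℝ)) := by
        rw [Real.sqrt_prod _ fun _ _ => Nat.cast_nonneg _]
        simp only [h.frob_eq_one, mul_one]
    _ ≤ ρ * signal A * √(∏ k, (m k : ℝ)) :=
        mul_le_mul_of_nonneg_right hF (Real.sqrt_nonneg _)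

theorem IsAligned.signalHat_div_signal_nonneg (hr : 0 < r) (h : IsAligned A s B)
    (hsignal : 0 < signal A) {ρ : ℝ} (hF : mlNorm F ≤ ρ * signal A)
    (hρ : √(∏ k, (m k : ℝ)) * ρ ≤ √(1 - s ^ 2) ^ r) :
    0 ≤ signalHat (tucker (gram A) + F) B / signal A := by
  rw [signalHat_tucker_gram_add_div_signal]
  have hnoise := neg_le_of_abs_le (h.abs_signalHat_div_signal_le hr hsignal hF)
  linarith [h.sqrt_pow_le_prod_inner]

theorem IsAligned.abs_signalHat_div_signal_sub_one_le (hr : 0 < r) (h : IsAligned A s B)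
    (hs : s ^ 2 ≤ 1) (hsignal : 0 < signal A) {ρ : ℝ} (hF : mlNorm F ≤ ρ * signal A) :
    |signalHat (tucker (gram A) + F) B / signal A - 1| ≤
      r * s ^ 2 + √(∏ k, (m k : ℝ)) * ρ := by
  rw [signalHat_tucker_gram_add_div_signal]
  obtain ⟨hnoise, hnoise'⟩ := abs_le.1 (h.abs_signalHat_div_signal_le hr hsignal hF)
  have hle := h.prod_inner_le_one (frob_gram_pos hsignal)
  have hge := (one_sub_mul_le_sqrt_pow (sq_nonneg s) hs r).trans h.sqrt_pow_le_prod_inner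
  have hnonneg : 0 ≤ r * s ^ 2 := by positivity
  exact abs_le.2 ⟨by linarith, by linarith⟩

theorem gramHat_eq_smul (hr : 0 < r) (hscale : ∀ k l, frob (gram A k) = frob (gram A l))
    (hsignal : 0 < signal A) (ht : 0 ≤ signalHat S B / signal A) (k : Fin r) :
    gramHat S B k =
      frob (gram A k) • (signalHat S B / signal A) ^ (1 / (r : ℝ)) • B k := by
  have hsplit : signalHat S B = frob (gram A k) ^ r * (signalHat S B / signal A) := by
    rw [← signal_eq_frob_gram_pow hscale, mul_div_cancel₀ _ hsignal.ne']
  have hroot : signalHat S B ^ (1 / (r : ℝ)) =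
      frob (gram A k) * (signalHat S B / signal A) ^ (1 / (r : ℝ)) := by
    conv_lhs => rw [hsplit]
    rw [Real.mul_rpow (pow_nonneg (frob_nonneg _) _) ht, one_div,
      Real.pow_rpow_inv_natCast (frob_nonneg _) hr.ne']
  rw [gramHat, hroot, mul_smul]

theorem IsAligned.frob_gramHat_sub_le (hr : 0 < r) (h : IsAligned A s B) (hs₀ : 0 ≤ s)
    (hs₁ : s ≤ 1) (hscale : ∀ k l, frob (gram A k) = frob (gram A l)) (hsignal : 0 < signal A)
    {δ : ℝ} (ht : 0 ≤ signalHat S B / signal A) (hδ : |signalHat S B / signal A - 1| ≤ δ)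
    (k : Fin r) : frob (gramHat S B k - gram A k) ≤ frob (gram A k) * (√2 * s + δ) := by
  have hG := frob_gram_pos hsignal k
  have hB : ‖vec (B k)‖ = 1 := h.frob_eq_one k
  set t := (signalHat S B / signal A) ^ (1 / (r : ℝ)) with ht_def
  have hroot : |t - 1| ≤ δ :=
    (abs_rpow_sub_one_le ht (by positivity) (by
      rw [div_le_one (by positivity)]
      exact mod_cast hr)).trans hδ
  have hsplit : vec (gramHat S B k - gram A k) =
      frob (gram A k) • ((vec (B k) - unitGram A k) + (t - 1) • vec (B k)) := by
    rw [gramHat_eq_smul hr hscale hsignal ht, vec_sub, vec_smul, vec_smul, ← ht_def,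
      ← frob_smul_unitGram hG]
    module
  rw [frob, hsplit, norm_smul, Real.norm_of_nonneg hG.le]
  refine mul_le_mul_of_nonneg_left ((norm_add_le _ _).trans (add_le_add ?_ ?_)) hG.le
  · exact norm_sub_le_sqrt_two_mul hB (norm_unitGram hG) hs₀ hs₁ (h.sqrt_le_inner k)
  · rwa [norm_smul, hB, mul_one, Real.norm_eq_abs]

theorem IsAligned.abs_trace_gramHat_sub_le (hr : 0 < r) (h : IsAligned A s B) (hs₀ : 0 ≤ s)
    (hs₁ : s ≤ 1) (hscale : ∀ k l, frob (gram A k) = frob (gram A l)) (hsignal : 0 < signal A)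
    {δ : ℝ} (ht : 0 ≤ signalHat S B / signal A) (hδ : |signalHat S B / signal A - 1| ≤ δ)
    (k : Fin r) :
    |(gramHat S B k).trace - (gram A k).trace| ≤
      √(m k) * frob (gram A k) * (2 * s + √2 * δ) := by
  have hherm : (gramHat S B k - gram A k).IsHermitian :=
    ((h.isHermitian k).smul (IsSelfAdjoint.all _)).sub (gram_posSemidef A k).1
  have hrank : (gramHat S B k - gram A k).rank ≤ 2 * m k := by
    rw [two_mul]
    exact (matrixRank_sub_le _ _).trans
      (add_le_add ((matrixRank_smul_le _ _).trans (h.rank_le k)) (rank_gram_le A k))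
  rw [← Matrix.trace_sub]
  calc |(gramHat S B k - gram A k).trace|
      ≤ √(2 * m k : ℕ) * frob (gramHat S B k - gram A k) := abs_trace_le_sqrt_mul_frob hherm hrank
    _ ≤ √(2 * m k : ℕ) * (frob (gram A k) * (√2 * s + δ)) := mul_le_mul_of_nonneg_left
        (h.frob_gramHat_sub_le hr hs₀ hs₁ hscale hsignal ht hδ k) (Real.sqrt_nonneg _)
    _ = √(m k) * frob (gram A k) * (√2 * √2 * s + √2 * δ) := by
        rw [Nat.cast_mul, Real.sqrt_mul (Nat.cast_nonneg _)]
        push_cast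
        ring
    _ = √(m k) * frob (gram A k) * (2 * s + √2 * δ) := by
        rw [Real.mul_self_sqrt zero_le_two]

theorem IsAligned.abs_trace_tucker_gramHat_sub_le (hr : 0 < r) (h : IsAligned A s B) (hs₀ : 0 ≤ s)
    (hs₁ : s ≤ 1) (hscale : ∀ k l, frob (gram A k) = frob (gram A l)) (hsignal : 0 < signal A)
    {δ : ℝ} (ht : 0 ≤ signalHat S B / signal A) (hδ : |signalHat S B / signal A - 1| ≤ δ) :
    |(tucker (gramHat S B)).trace - (tucker (gram A)).trace| ≤
      √(∏ k, (m k : ℝ)) * signal A * ((1 + (2 * s + √2 * δ)) ^ r - 1) := by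
  rw [trace_tucker, trace_tucker]
  refine (abs_prod_sub_prod_le Finset.univ (Y := fun k => √(m k) * frob (gram A k))
    (fun k => abs_trace_le_sqrt_mul_frob (gram_posSemidef A k).1 (rank_gram_le A k)) fun k =>
      h.abs_trace_gramHat_sub_le hr hs₀ hs₁ hscale hsignal ht hδ k).trans_eq ?_
  rw [Finset.prod_mul_distrib, Finset.card_univ, Fintype.card_fin, signal,
    Real.sqrt_prod _ fun _ _ => Nat.cast_nonneg _]

theorem IsIteration.abs_trace_tucker_gramHat_sub_le (hr : 0 < r)
    (hscale : ∀ k l, frob (gram A k) = frob (gram A l)) (hsignal : 0 < signal A) {ρ τ : ℝ}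
    (hF : mlNorm F ≤ ρ * signal A) (hτ : τ < tauOne r (∏ k, (m k : ℝ)) ρ)
    (hB : IsFeasible m B) (hsin : ∀ k, Real.sin (initAngle A k (B k)) ≤ τ)
    (hit : IsIteration m (tucker (gram A) + F) B B') :
    |(tucker (gramHat (tucker (gram A) + F) B')).trace - (tucker (gram A)).trace| ≤
      √(∏ k, (m k : ℝ)) * signal A *
        ((1 + 2 * f₁ r (∏ k, (m k : ℝ)) ρ τ + √2 * f₂ r (∏ k, (m k : ℝ)) ρ τ) ^ r - 1) := by
  have hM : 0 ≤ ∏ k, (m k : ℝ) := Finset.prod_nonneg fun _ _ => Nat.cast_nonneg _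
  have hρ : 0 ≤ ρ := nonneg_of_mul_nonneg_left ((mlNorm_nonneg hr F).trans hF) hsignal
  have hτ₀ : 0 ≤ τ := (InnerProductGeometry.sin_angle_nonneg _ _).trans (hsin ⟨0, hr⟩)
  have hτ₁ := one_sub_sq_pos_of_lt_tauOne hτ₀ hτ
  have hf₀ : 0 ≤ f₁ r (∏ k, (m k : ℝ)) ρ τ := f₁_nonneg hρ hτ₁.le
  have hf₁ := f₁_lt_one hr hM hτ₀ hτ
  have hsmall := sqrt_mul_le_sqrt_one_sub_f₁_sq_pow hr hM hτ₀ hτ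
  have hf₁_eq := sqrt_pow_mul_f₁ (M := ∏ k, (m k : ℝ)) (ρ := ρ) hr hτ₁
  have hf₂_eq := f₂_eq (ρ := ρ) hr hM hτ₁
  set f := f₁ r (∏ k, (m k : ℝ)) ρ τ
  have haligned : IsAligned A (f / 2) B' := by
    refine hit.isAligned hr (frob_gram_pos hsignal) hτ₁ (by positivity) (by linarith) ?_ hB hsin
    calc 2 * √2 * (√(∏ k, (m k : ℝ)) * mlNorm F)
        ≤ 2 * √2 * (√(∏ k, (m k : ℝ)) * (ρ * signal A)) := by gcongr
      _ = signal A * (4 * √(2 * ∏ k, (m k : ℝ)) * ρ) / 2 := by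
          rw [Real.sqrt_mul zero_le_two]
          ring
      _ = signal A * √(1 - τ ^ 2) ^ (r - 1) * (f / 2) := by
          rw [← hf₁_eq]
          ring
  have ht := haligned.signalHat_div_signal_nonneg hr hsignal hF hsmall
  have hδ := haligned.abs_signalHat_div_signal_sub_one_le hr (pow_le_one₀ (by positivity)
    (by linarith)) hsignal hF
  have hrf : 0 ≤ r * f ^ 2 := by positivity
  refine (haligned.abs_trace_tucker_gramHat_sub_le hr (by positivity) (by linarith) hscale hsignal
    ht (hδ.trans (by linarith : _ ≤ f₂ r (∏ k, (m k : ℝ)) ρ τ))).trans ?_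
  rw [← add_assoc]
  have hf₂ : 0 ≤ f₂ r (∏ k, (m k : ℝ)) ρ τ := by
    rw [hf₂_eq]
    positivity
  gcongr
  linarith

end Deterministic

/-! ### Concentration of weighted chi-square variables -/

theorem sq_mul_neg_log_one_sub_sub_le {y c : ℝ} (hy : 0 ≤ y) (hyc : y ≤ c) (hc : c < 1) :
    c ^ 2 * (-Real.log (1 - y) - y) ≤ y ^ 2 * (-Real.log (1 - c) - c) := by
  have taylor (z : ℝ) (hz₀ : 0 ≤ z) (hz₁ : z < 1) :
      HasSum (fun k : ℕ => z ^ (k + 2) / ((k : ℝ) + 2)) (-Real.log (1 - z) - z) := by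
    have h := (hasSum_nat_add_iff' 1).2
      (Real.hasSum_pow_div_log_of_abs_lt_one (by rwa [abs_of_nonneg hz₀]))
    simpa [add_assoc, one_add_one_eq_two] using h
  refine hasSum_le (fun k => ?_) ((taylor y hy (hyc.trans_lt hc)).mul_left (c ^ 2))
    ((taylor c (hy.trans hyc) hc).mul_left (y ^ 2))
  rw [← mul_div_assoc, ← mul_div_assoc]
  refine div_le_div_of_nonneg_right ?_ (by positivity)
  calc c ^ 2 * y ^ (k + 2) = (y * c) ^ 2 * y ^ k := by ring
    _ ≤ (y * c) ^ 2 * c ^ k := by gcongr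
    _ = y ^ 2 * c ^ (k + 2) := by ring

theorem neg_log_one_sub_le {y : ℝ} (hy₀ : 0 ≤ y) (hy : y ≤ 1 / 2) :
    -Real.log (1 - y) ≤ y + (4 * Real.log 2 - 2) * y ^ 2 := by
  have h := sq_mul_neg_log_one_sub_sub_le hy₀ hy (by norm_num)
  have hlog : Real.log (1 - 1 / 2) = -Real.log 2 := by
    rw [← Real.log_inv]
    norm_num
  rw [hlog] at h
  linarith

theorem neg_log_one_sub_le_of_nonpos {y : ℝ} (hy : y ≤ 0) :
    -Real.log (1 - y) ≤ y + 1 / 2 * y ^ 2 := by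
  have hpade : -y - 1 / 2 * y ^ 2 ≤ 2 * -y / (-y + 2) := by
    rw [le_div_iff₀ (by linarith)]
    nlinarith [mul_nonneg (neg_nonneg.2 hy) (sq_nonneg y)]
  have hlog := Real.le_log_one_add_of_nonneg (neg_nonneg.2 hy)
  rw [← sub_eq_add_neg] at hlog
  linarith

theorem inv_sqrt_one_sub_le_exp {K y : ℝ} (hy : y < 1)
    (hK : -Real.log (1 - y) ≤ y + K * y ^ 2) :
    (√(1 - y))⁻¹ ≤ Real.exp (y / 2 + K * y ^ 2 / 2) := by
  rw [← Real.log_le_iff_le_exp (inv_pos.2 (Real.sqrt_pos.2 (by linarith))), Real.log_inv,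
    Real.log_sqrt (by linarith)]
  linarith

theorem integral_exp_mul_sq_gaussianReal {v : NNReal} {s : ℝ} (h : 2 * s * v < 1) :
    ∫ x, Real.exp (s * x ^ 2) ∂(gaussianReal 0 v) = (√(1 - 2 * s * v))⁻¹ := by
  rcases eq_or_ne v 0 with rfl | hv
  · simp
  have hv_pos : 0 < (v : ℝ) := NNReal.coe_pos.2 (pos_iff_ne_zero.2 hv)
  have hdensity (x : ℝ) : gaussianPDFReal 0 v x • Real.exp (s * x ^ 2) =
      (√(2 * Real.pi * v))⁻¹ * Real.exp (-(1 / (2 * v) - s) * x ^ 2) := by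
    rw [gaussianPDFReal_def, smul_eq_mul, mul_assoc, ← Real.exp_add]
    congr 2
    field_simp
    ring
  have hcoef : 1 / (2 * (v : ℝ)) - s = (1 - 2 * s * v) / (2 * v) := by field_simp
  have hne : 1 - 2 * s * (v : ℝ) ≠ 0 := by linarith
  rw [integral_gaussianReal_eq_integral_smul hv]
  simp only [hdensity]
  rw [integral_const_mul, integral_gaussian, ← Real.sqrt_inv, ← Real.sqrt_inv,
    ← Real.sqrt_mul (by positivity), hcoef]
  congr 1
  field_simp

section ChiSquare

variable {Ω : Type*} [MeasurableSpace Ω] {P : Measure Ω}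

theorem mgf_sq_of_hasLaw_gaussianReal {Y : Ω → ℝ} {v : NNReal}
    (hY : HasLaw Y (gaussianReal 0 v) P) {s : ℝ} (h : 2 * s * v < 1) :
    mgf (fun ω => Y ω ^ 2) P s = (√(1 - 2 * s * v))⁻¹ := by
  rw [← integral_exp_mul_sq_gaussianReal h, ← hY.map_eq, integral_map hY.aemeasurable (by fun_prop)]
  rfl

variable {ι : Type*} [Fintype ι] {Y : ι → Ω → ℝ} {v : ι → NNReal}

theorem mgf_sum_sq_of_hasLaw_gaussianReal (hlaw : ∀ i, HasLaw (Y i) (gaussianReal 0 (v i)) P)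
    (hindep : iIndepFun Y P) {s : ℝ} (hs : ∀ i, 2 * s * v i < 1) :
    mgf (fun ω => ∑ i, Y i ω ^ 2) P s = ∏ i, (√(1 - 2 * s * v i))⁻¹ := by
  have hsq : iIndepFun (fun i ω => Y i ω ^ 2) P := hindep.comp (fun _ x => x ^ 2) (by fun_prop)
  have hmgf := hsq.mgf_sum₀ (t := s) (fun i => (hlaw i).aemeasurable.pow_const 2) Finset.univ
  rw [show (∑ i, fun ω => Y i ω ^ 2) = fun ω => ∑ i, Y i ω ^ 2 by ext; simp] at hmgf
  rw [hmgf]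
  exact Finset.prod_congr rfl fun i _ => mgf_sq_of_hasLaw_gaussianReal (hlaw i) (hs i)

theorem integrable_exp_mul_sum_sq (hlaw : ∀ i, HasLaw (Y i) (gaussianReal 0 (v i)) P)
    (hindep : iIndepFun Y P) {s : ℝ} (hs : ∀ i, 2 * s * v i < 1) :
    Integrable (fun ω => Real.exp (s * ∑ i, Y i ω ^ 2)) P := by
  refine Integrable.of_integral_ne_zero ?_
  change mgf (fun ω => ∑ i, Y i ω ^ 2) P s ≠ 0
  rw [mgf_sum_sq_of_hasLaw_gaussianReal hlaw hindep hs]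
  exact Finset.prod_ne_zero_iff.2 fun i _ =>
    inv_ne_zero (Real.sqrt_pos.2 (sub_pos.2 (hs i))).ne'

theorem mgf_sum_sq_le (hlaw : ∀ i, HasLaw (Y i) (gaussianReal 0 (v i)) P)
    (hindep : iIndepFun Y P) {s K : ℝ} (hs : ∀ i, 2 * s * v i < 1)
    (hK : ∀ i, -Real.log (1 - 2 * s * v i) ≤ 2 * s * v i + K * (2 * s * v i) ^ 2) :
    mgf (fun ω => ∑ i, Y i ω ^ 2) P s ≤
      Real.exp (s * ∑ i, (v i : ℝ) + 2 * K * s ^ 2 * ∑ i, (v i : ℝ) ^ 2) := by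
  rw [mgf_sum_sq_of_hasLaw_gaussianReal hlaw hindep hs, Finset.mul_sum, Finset.mul_sum,
    ← Finset.sum_add_distrib, Real.exp_sum]
  refine Finset.prod_le_prod (fun i _ => by positivity) fun i _ => ?_
  refine (inv_sqrt_one_sub_le_exp (hs i) (hK i)).trans_eq ?_
  ring_nf

variable {L Q : ℝ}

theorem measureReal_add_le_sum_sq_le (hlaw : ∀ i, HasLaw (Y i) (gaussianReal 0 (v i)) P)
    (hindep : iIndepFun Y P) (hL : 0 < L) (hvL : ∀ i, v i ≤ L)
    (hQ : ∑ i, (v i : ℝ) ^ 2 ≤ Q * L ^ 2) (x : ℝ) {y : ℝ} (hy₀ : 0 ≤ y) (hy : y ≤ 1 / 2) :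
    P.real {ω | ∑ i, (v i : ℝ) + Q * L * x ≤ ∑ i, Y i ω ^ 2} ≤
      Real.exp (-(Q * (y * x / 2 - (2 * Real.log 2 - 1) * y ^ 2))) := by
  have := hindep.isProbabilityMeasure
  have hscaled (i : ι) : 2 * (y / (2 * L)) * v i = y * (v i / L) := by field_simp
  have hle (i : ι) : y * (v i / L) ≤ y :=
    mul_le_of_le_one_right hy₀ ((div_le_one hL).2 (hvL i))
  have hs (i : ι) : 2 * (y / (2 * L)) * v i < 1 := by linarith [hscaled i, hle i]
  have hK : 0 ≤ 4 * Real.log 2 - 2 := by linarith [Real.log_two_gt_d9]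
  have hmgf := mgf_sum_sq_le hlaw hindep (K := 4 * Real.log 2 - 2) hs fun i => by
    rw [hscaled]
    exact neg_log_one_sub_le (by positivity) ((hle i).trans hy)
  refine (measure_ge_le_exp_mul_mgf _ (by positivity)
    (integrable_exp_mul_sum_sq hlaw hindep hs)).trans ?_
  refine (mul_le_mul_of_nonneg_left hmgf (Real.exp_pos _).le).trans ?_
  rw [← Real.exp_add, Real.exp_le_exp]
  have hquad := mul_le_mul_of_nonneg_left hQ
    (show 0 ≤ 2 * (4 * Real.log 2 - 2) * (y / (2 * L)) ^ 2 by positivity)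
  have hlin : y / (2 * L) * (Q * L * x) = Q * (y * x / 2) := by field_simp
  have hconst : 2 * (4 * Real.log 2 - 2) * (y / (2 * L)) ^ 2 * (Q * L ^ 2) =
      Q * ((2 * Real.log 2 - 1) * y ^ 2) := by
    field_simp
    ring
  linarith

theorem measureReal_sum_sq_le_sub_le (hlaw : ∀ i, HasLaw (Y i) (gaussianReal 0 (v i)) P)
    (hindep : iIndepFun Y P) (hL : 0 < L) (hQ : ∑ i, (v i : ℝ) ^ 2 ≤ Q * L ^ 2)
    {x : ℝ} (hx : 0 ≤ x) :
    P.real {ω | ∑ i, Y i ω ^ 2 ≤ ∑ i, (v i : ℝ) - Q * L * x} ≤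
      Real.exp (-(Q * (x ^ 2 / 4))) := by
  have := hindep.isProbabilityMeasure
  have hs₀ : -x / (2 * L) ≤ 0 := div_nonpos_of_nonpos_of_nonneg (by linarith) (by positivity)
  have hs (i : ι) : 2 * (-x / (2 * L)) * v i ≤ 0 :=
    mul_nonpos_of_nonpos_of_nonneg (by linarith) (v i).2
  have hmgf := mgf_sum_sq_le hlaw hindep (fun i => (hs i).trans_lt one_pos)
    fun i => neg_log_one_sub_le_of_nonpos (hs i)
  refine (measure_le_le_exp_mul_mgf _ hs₀
    (integrable_exp_mul_sum_sq hlaw hindep fun i => (hs i).trans_lt one_pos)).trans ?_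
  refine (mul_le_mul_of_nonneg_left hmgf (Real.exp_pos _).le).trans ?_
  rw [← Real.exp_add, Real.exp_le_exp]
  have hquad := mul_le_mul_of_nonneg_left hQ
    (show 0 ≤ 2 * (1 / 2) * (-x / (2 * L)) ^ 2 by positivity)
  have hlin : -x / (2 * L) * (Q * L * x) = -(Q * (x ^ 2 / 2)) := by field_simp
  have hconst : 2 * (1 / 2) * (-x / (2 * L)) ^ 2 * (Q * L ^ 2) = Q * (x ^ 2 / 4) := by
    field_simp
    ring
  linarith

theorem measureReal_add_le_sum_sq_le_of_min (hlaw : ∀ i, HasLaw (Y i) (gaussianReal 0 (v i)) P)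
    (hindep : iIndepFun Y P) (hL : 0 < L) (hvL : ∀ i, v i ≤ L) (hQ₀ : 0 ≤ Q)
    (hQ : ∑ i, (v i : ℝ) ^ 2 ≤ Q * L ^ 2) {x : ℝ} (hx : 0 ≤ x) :
    P.real {ω | ∑ i, (v i : ℝ) + Q * L * x ≤ ∑ i, Y i ω ^ 2} ≤
      Real.exp (-(Q * ((1 - Real.log 2) / 2 * min x (x ^ 2)))) := by
  have hy := min_le_right x 1
  refine (measureReal_add_le_sum_sq_le hlaw hindep hL hvL hQ x (y := min x 1 / 2)
    (by positivity) (by linarith)).trans ?_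
  refine Real.exp_le_exp.2 (neg_le_neg (mul_le_mul_of_nonneg_left ?_ hQ₀))
  rcases le_total x 1 with h | h
  · rw [min_eq_left h, min_eq_right (by nlinarith)]
    exact le_of_eq (by ring)
  · rw [min_eq_right h, min_eq_left (by nlinarith)]
    nlinarith [Real.log_two_gt_d9]

theorem exp_neg_add_exp_neg_le_one {a b : ℝ} (ha : 0.16 ≤ a) (hb : 2 ≤ b) :
    Real.exp (-a) + Real.exp (-b) ≤ 1 := by
  have hexp_b : Real.exp (-b) ≤ 0.1354 := by
    calc Real.exp (-b) ≤ Real.exp (-1) ^ 2 := by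
          rw [← Real.exp_nat_mul]
          exact Real.exp_le_exp.2 (by norm_num; linarith)
      _ ≤ 0.3679 ^ 2 := by gcongr; linarith [Real.exp_neg_one_lt_d9]
      _ ≤ 0.1354 := by norm_num
  have hexp_a : Real.exp (-a) ≤ 1 / 1.1728 := by
    rw [Real.exp_neg, ← one_div]
    refine one_div_le_one_div_of_le (by norm_num) ?_
    have := Real.quadratic_le_exp_of_nonneg (show 0 ≤ a by linarith)
    nlinarith
  linarith [show (1 / 1.1728 : ℝ) ≤ 0.86 by norm_num]

theorem exp_neg_add_exp_neg_le_one_div_sq {d a b : ℝ} (hd : 0 < d)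
    (ha : 2 * Real.log d + 0.16 ≤ a) (hb : 2 * Real.log d + 2 ≤ b) :
    Real.exp (-a) + Real.exp (-b) ≤ 1 / d ^ 2 := by
  have hd_sq : 1 / d ^ 2 = Real.exp (-(2 * Real.log d)) := by
    rw [Real.exp_neg, two_mul, Real.exp_add, Real.exp_log hd, one_div, sq]
  have hfactor (c : ℝ) :
      Real.exp (-c) = Real.exp (-(2 * Real.log d)) * Real.exp (-(c - 2 * Real.log d)) := by
    rw [← Real.exp_add]
    ring_nf
  rw [hd_sq, hfactor a, hfactor b, ← mul_add]
  exact mul_le_of_le_one_right (Real.exp_pos _).le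
    (exp_neg_add_exp_neg_le_one (by linarith) (by linarith))

theorem self_le_maxSqrt (α : ℝ) : α ≤ maxSqrt α := le_max_left _ _

theorem maxSqrt_nonneg (α : ℝ) : 0 ≤ maxSqrt α := (Real.sqrt_nonneg α).trans (le_max_right _ _)

theorem self_le_maxSqrt_sq (α : ℝ) : α ≤ maxSqrt α ^ 2 := by
  refine (le_max_left α 0).trans ?_
  rw [← Real.sq_sqrt']
  exact pow_le_pow_left₀ (Real.sqrt_nonneg α) (le_max_right _ _) 2

theorem measureReal_abs_sum_sq_sub_lt_le_add
    (hlaw : ∀ i, HasLaw (Y i) (gaussianReal 0 (v i)) P) (hindep : iIndepFun Y P) (hL : 0 < L)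
    (hQ : ∑ i, (v i : ℝ) ^ 2 ≤ Q * L ^ 2) {x u : ℝ} (hx : 0 ≤ x)
    (hupper : P.real {ω | ∑ i, (v i : ℝ) + Q * L * x ≤ ∑ i, Y i ω ^ 2} ≤ Real.exp (-u)) :
    P.real {ω | Q * L * x < |∑ i, Y i ω ^ 2 - ∑ i, (v i : ℝ)|} ≤
      Real.exp (-u) + Real.exp (-(Q * (x ^ 2 / 4))) := by
  have := hindep.isProbabilityMeasure
  refine (measureReal_mono ?_).trans ((measureReal_union_le _ _).trans
    (add_le_add hupper (measureReal_sum_sq_le_sub_le hlaw hindep hL hQ hx)))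
  intro ω (hω : Q * L * x < |∑ i, Y i ω ^ 2 - ∑ i, (v i : ℝ)|)
  rcases lt_abs.1 hω with h | h
  · exact Or.inl (Set.mem_ofPred.2 (by linarith))
  · exact Or.inr (Set.mem_ofPred.2 (by linarith))

/-- The constant `0.145` is below `(1 - log 2) / 2 ≈ 0.1534`, the rate of the upper tail; the
surplus `0.116 * log d` in the exponent pays for the union bound over the two tails. -/
theorem measureReal_abs_sum_sq_sub_lt_le_of_four_le
    (hlaw : ∀ i, HasLaw (Y i) (gaussianReal 0 (v i)) P) (hindep : iIndepFun Y P) (hL : 0 < L)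
    (hvL : ∀ i, v i ≤ L) (hQ₀ : 0 ≤ Q) (hQ : ∑ i, (v i : ℝ) ^ 2 ≤ Q * L ^ 2) {d α : ℝ} (hd : 4 ≤ d)
    (hα : 0.145 * (Q * α) = 2 * Real.log d) :
    P.real {ω | Q * L * maxSqrt α < |∑ i, Y i ω ^ 2 - ∑ i, (v i : ℝ)|} ≤ 1 / d ^ 2 := by
  have hlog_two := Real.log_two_gt_d9
  have hlog_two' := Real.log_two_lt_d9
  have hlog : 2 * Real.log 2 ≤ Real.log d := by
    rw [← Real.log_rpow two_pos]
    exact Real.log_le_log (by positivity) (by norm_num; exact hd)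
  have hupper : Q * ((1 - Real.log 2) / 2 * α) ≤
      Q * ((1 - Real.log 2) / 2 * min (maxSqrt α) (maxSqrt α ^ 2)) :=
    mul_le_mul_of_nonneg_left (mul_le_mul_of_nonneg_left
      (le_min (self_le_maxSqrt α) (self_le_maxSqrt_sq α)) (by linarith)) hQ₀
  have hlower : Q * (α / 4) ≤ Q * (maxSqrt α ^ 2 / 4) := by
    have := self_le_maxSqrt_sq α
    gcongr
  refine (measureReal_abs_sum_sq_sub_lt_le_add hlaw hindep hL hQ (maxSqrt_nonneg α)
    (measureReal_add_le_sum_sq_le_of_min hlaw hindep hL hvL hQ₀ hQ (maxSqrt_nonneg α))).trans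
    (exp_neg_add_exp_neg_le_one_div_sq (by linarith) ?_ (by linarith))
  nlinarith

theorem measureReal_abs_sum_sq_sub_lt_le_of_three_le
    (hlaw : ∀ i, HasLaw (Y i) (gaussianReal 0 (v i)) P) (hindep : iIndepFun Y P) (hL : 0 < L)
    (hvL : ∀ i, v i ≤ L) (hQ₀ : 0 ≤ Q) (hQ : ∑ i, (v i : ℝ) ^ 2 ≤ Q * L ^ 2) {d α : ℝ} (hd : 2 ≤ d)
    (hα₃ : 3 ≤ α) (hα : 0.145 * (Q * α) = 2 * Real.log d) :
    P.real {ω | Q * L * maxSqrt α < |∑ i, Y i ω ^ 2 - ∑ i, (v i : ℝ)|} ≤ 1 / d ^ 2 := by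
  have hlog_two := Real.log_two_gt_d9
  have hlog_two' := Real.log_two_lt_d9
  have hlog : Real.log 2 ≤ Real.log d := Real.log_le_log two_pos hd
  have hle := self_le_maxSqrt α
  have hupper : Q * (0.215 * α) ≤
      Q * (1 / 2 * maxSqrt α / 2 - (2 * Real.log 2 - 1) * (1 / 2) ^ 2) :=
    mul_le_mul_of_nonneg_left (by linarith) hQ₀
  have hlower : Q * (3 / 4 * α) ≤ Q * (maxSqrt α ^ 2 / 4) :=
    mul_le_mul_of_nonneg_left (by nlinarith) hQ₀
  exact (measureReal_abs_sum_sq_sub_lt_le_add hlaw hindep hL hQ (maxSqrt_nonneg α)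
    (measureReal_add_le_sum_sq_le hlaw hindep hL hvL hQ _ (by norm_num) le_rfl)).trans
    (exp_neg_add_exp_neg_le_one_div_sq (by linarith) (by linarith) (by linarith))

theorem measureReal_abs_sum_sq_sub_lt_le (hlaw : ∀ i, HasLaw (Y i) (gaussianReal 0 (v i)) P)
    (hindep : iIndepFun Y P) (hL : 0 < L) (hvL : ∀ i, v i ≤ L) (hQ₀ : 0 < Q)
    (hQ : ∑ i, (v i : ℝ) ^ 2 ≤ Q * L ^ 2) {d : ℕ} (hQd : Q ≤ d) {α : ℝ}
    (hα : 0.145 * (Q * α) = 2 * Real.log d) :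
    P.real {ω | Q * L * maxSqrt α < |∑ i, Y i ω ^ 2 - ∑ i, (v i : ℝ)|} ≤ 1 / (d : ℝ) ^ 2 := by
  have := hindep.isProbabilityMeasure
  have hd₀ : 0 < d := Nat.cast_pos.1 (hQ₀.trans_le hQd)
  rcases le_or_gt 4 d with hd₄ | hd₄
  · exact measureReal_abs_sum_sq_sub_lt_le_of_four_le hlaw hindep hL hvL hQ₀.le hQ
      (by exact_mod_cast hd₄) hα
  rcases le_or_gt d 1 with hd₁ | hd₁
  · simp [le_antisymm hd₁ hd₀]
  have hd₂ : (2 : ℝ) ≤ d := by exact_mod_cast hd₁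
  have hd₃ : (d : ℝ) ≤ 3 := by exact_mod_cast Nat.le_of_lt_succ hd₄
  refine measureReal_abs_sum_sq_sub_lt_le_of_three_le hlaw hindep hL hvL hQ₀.le hQ hd₂ ?_ hα
  by_contra! h
  have := Real.log_le_log two_pos hd₂
  nlinarith [Real.log_two_gt_d9]

end ChiSquare

/-! ### Gaussian vectors -/

section GaussianVector

variable {ι : Type*} [Fintype ι] [DecidableEq ι] {S : Matrix ι ι ℝ}

theorem covarianceBilin_multivariateGaussian_eigenvectorBasis (hS : S.PosSemidef)
    (μ : EuclideanSpace ℝ ι) (j j' : ι) :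
    covarianceBilin (multivariateGaussian μ S) (hS.1.eigenvectorBasis j)
      (hS.1.eigenvectorBasis j') = if j = j' then hS.1.eigenvalues j else 0 := by
  rw [covarianceBilin_multivariateGaussian hS, hS.1.mulVec_eigenvectorBasis, dotProduct_smul]
  have hortho := hS.1.eigenvectorBasis.inner_eq_ite j j'
  simp only [PiLp.inner_apply, RCLike.inner_apply, conj_trivial] at hortho
  simp only [dotProduct, mul_comm (hS.1.eigenvectorBasis j _), hortho, smul_eq_mul]
  split_ifs with h <;> simp [h]

variable {Ω : Type*} [MeasurableSpace Ω] {P : Measure Ω}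

theorem cov_inner_eigenvectorBasis {X : Ω → EuclideanSpace ℝ ι} {μ : EuclideanSpace ℝ ι}
    (hX : HasLaw X (multivariateGaussian μ S) P) (hS : S.PosSemidef) (j j' : ι) :
    cov[fun ω => inner ℝ (hS.1.eigenvectorBasis j) (X ω),
      fun ω => inner ℝ (hS.1.eigenvectorBasis j') (X ω); P] =
      if j = j' then hS.1.eigenvalues j else 0 := by
  rw [← covarianceBilin_multivariateGaussian_eigenvectorBasis hS μ,
    covarianceBilin_apply_eq_cov IsGaussian.memLp_two_id, ← hX.map_eq,
    covariance_map (by fun_prop) (by fun_prop) hX.aemeasurable]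
  rfl

theorem hasLaw_inner_eigenvectorBasis {X : Ω → EuclideanSpace ℝ ι}
    (hX : HasLaw X (multivariateGaussian 0 S) P) (hS : S.PosSemidef) (j : ι) :
    HasLaw (fun ω => inner ℝ (hS.1.eigenvectorBasis j) (X ω))
      (gaussianReal 0 (hS.1.eigenvalues j).toNNReal) P where
  aemeasurable := hX.aemeasurable.const_inner
  map_eq := by
    have hgauss : HasGaussianLaw (fun ω => inner ℝ (hS.1.eigenvectorBasis j) (X ω)) P :=
      hX.hasGaussianLaw.map_fun (innerSL ℝ (hS.1.eigenvectorBasis j))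
    have hmean : ∫ ω, inner ℝ (hS.1.eigenvectorBasis j) (X ω) ∂P = 0 := by
      rw [integral_inner hX.hasGaussianLaw.integrable, hX.integral_eq,
        integral_id_multivariateGaussian, inner_zero_right]
    rw [hgauss.map_eq_gaussianReal, hmean, ← covariance_self hX.aemeasurable.const_inner,
      cov_inner_eigenvectorBasis hX hS, if_pos rfl]

variable {κ : Type*} {X : κ → Ω → EuclideanSpace ℝ ι}

theorem iIndepFun_inner_eigenvectorBasis [Finite κ] {μ : EuclideanSpace ℝ ι}
    (hX : ∀ i, HasLaw (X i) (multivariateGaussian μ S) P) (hindep : iIndepFun X P)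
    (hS : S.PosSemidef) :
    iIndepFun (fun (p : κ × ι) ω => inner ℝ (hS.1.eigenvectorBasis p.2) (X p.1 ω)) P := by
  cases nonempty_fintype κ
  have hjoint := (hindep.hasGaussianLaw fun i => (hX i).hasGaussianLaw).map_fun
    (ContinuousLinearMap.pi fun p : κ × ι =>
      (innerSL ℝ (hS.1.eigenvectorBasis p.2)).comp (ContinuousLinearMap.proj p.1))
  refine HasGaussianLaw.iIndepFun_of_covariance_eq_zero hjoint ?_
  rintro ⟨i, j⟩ ⟨i', j'⟩ hne
  have hcoord (i : κ) (j : ι) :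
      MemLp (fun ω => inner ℝ (hS.1.eigenvectorBasis j) (X i ω)) 2 P :=
    (hX i).hasGaussianLaw.memLp_two.const_inner _
  rcases eq_or_ne i i' with rfl | hi
  · rw [cov_inner_eigenvectorBasis (hX i) hS, if_neg fun hj => hne (Prod.ext rfl hj)]
  · exact IndepFun.covariance_eq_zero ((hindep.indepFun hi).comp (by fun_prop) (by fun_prop))
      (hcoord i j) (hcoord i' j')

theorem measureReal_abs_sum_norm_sq_sub_trace_lt_le [Fintype κ]
    (hX : ∀ i, HasLaw (X i) (multivariateGaussian 0 S) P) (hindep : iIndepFun X P)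
    (hS : S.PosSemidef) {L Q : ℝ} (hL : 0 < L) (hSL : ∀ j, hS.1.eigenvalues j ≤ L) (hQ₀ : 0 < Q)
    (hQ : Fintype.card κ * ∑ j, hS.1.eigenvalues j ^ 2 ≤ Q * L ^ 2) {d : ℕ} (hQd : Q ≤ d)
    {α : ℝ} (hα : 0.145 * (Q * α) = 2 * Real.log d) :
    P.real {ω | Q * L * maxSqrt α < |∑ i, ‖X i ω‖ ^ 2 - Fintype.card κ * S.trace|} ≤
      1 / (d : ℝ) ^ 2 := by
  have hcoe (j : ι) : ((hS.1.eigenvalues j).toNNReal : ℝ) = hS.1.eigenvalues j :=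
    Real.coe_toNNReal _ (hS.eigenvalues_nonneg j)
  have hnorm (x : EuclideanSpace ℝ ι) :
      ‖x‖ ^ 2 = ∑ j, inner ℝ (hS.1.eigenvectorBasis j) x ^ 2 := by
    simpa using (hS.1.eigenvectorBasis.sum_sq_norm_inner_right x).symm
  have htail := measureReal_abs_sum_sq_sub_lt_le
    (fun p : κ × ι => hasLaw_inner_eigenvectorBasis (hX p.1) hS p.2)
    (iIndepFun_inner_eigenvectorBasis hX hindep hS) hL (fun p => (hcoe p.2).trans_le (hSL p.2)) hQ₀
    (by simpa [Fintype.sum_prod_type, hcoe] using hQ) hQd hα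
  simpa [Fintype.sum_prod_type, hcoe, hnorm, hS.1.trace_eq_sum_eigenvalues] using htail

end GaussianVector

section Model

variable {r : ℕ} {n m : Fin r → ℕ} {Ω : Type*} [MeasurableSpace Ω] {P : Measure Ω}

theorem inner_toEuclideanLin_left (M : Op m n) (z : Tensor m) (T : Tensor n) :
    (inner ℝ (Matrix.toEuclideanLin M z) T : ℝ) = inner ℝ z (Matrix.toEuclideanLin Mᵀ T) := by
  rw [← Matrix.conjTranspose_eq_transpose_of_trivial,
    Matrix.toEuclideanLin_conjTranspose_eq_adjoint, LinearMap.adjoint_inner_right]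

theorem IsGaussianTensor.hasLaw_inner {X : Ω → Tensor n} {μ : Tensor n} {S : Op n n}
    (h : IsGaussianTensor P X μ S) (T : Tensor n) :
    HasLaw (fun ω => inner ℝ (X ω) T)
      (gaussianReal (inner ℝ μ T) (inner ℝ (Matrix.toEuclideanLin S T) T).toNNReal) P :=
  ⟨h.1.inner_const, h.2 T⟩

theorem IsGaussianTensor.toEuclideanLin {Z : Ω → Tensor m} {ν : Tensor m} {S : Op m m}
    (h : IsGaussianTensor P Z ν S) (M : Op m n) :
    IsGaussianTensor P (fun ω => Matrix.toEuclideanLin M (Z ω)) (Matrix.toEuclideanLin M ν)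
      (M * S * Mᵀ) := by
  have hcont : Continuous (Matrix.toEuclideanLin M) := LinearMap.continuous_of_finiteDimensional _
  refine ⟨hcont.measurable.comp_aemeasurable h.1, fun T => ?_⟩
  simp only [inner_toEuclideanLin_left]
  rw [h.2, inner_toEuclideanLin_left, inner_toEuclideanLin_left]
  congr 3
  simp [Matrix.toLpLin_apply, Matrix.mulVec_mulVec, Matrix.mul_assoc]

theorem IsGaussianTensor.add {X Y : Ω → Tensor n} {μ ν : Tensor n} {S S' : Op n n}
    (hX : IsGaussianTensor P X μ S) (hY : IsGaussianTensor P Y ν S') (hXY : IndepFun X Y P)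
    (hS : S.PosSemidef) (hS' : S'.PosSemidef) :
    IsGaussianTensor P (fun ω => X ω + Y ω) (μ + ν) (S + S') := by
  refine ⟨hX.1.add hY.1, fun T => ?_⟩
  have hind : IndepFun (fun ω => (inner ℝ (X ω) T : ℝ)) (fun ω => inner ℝ (Y ω) T) P :=
    hXY.comp (φ := fun x => inner ℝ x T) (ψ := fun x => inner ℝ x T) (by fun_prop) (by fun_prop)
  have hsum := gaussianReal_add_gaussianReal_of_indepFun hind (hX.2 T) (hY.2 T)
  simp only [inner_add_left, map_add, LinearMap.add_apply]
  rw [Real.toNNReal_add, ← hsum]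
  · rfl
  · exact (Matrix.isPositive_toEuclideanLin_iff.2 hS).inner_nonneg_left T
  · exact (Matrix.isPositive_toEuclideanLin_iff.2 hS').inner_nonneg_left T

theorem IsGaussianTensor.const_add {X : Ω → Tensor n} {ν : Tensor n} {S : Op n n}
    (h : IsGaussianTensor P X ν S) (μ : Tensor n) :
    IsGaussianTensor P (fun ω => μ + X ω) (μ + ν) S := by
  refine ⟨h.1.const_add μ, fun T => ?_⟩
  simp only [inner_add_left]
  rw [add_comm (inner ℝ μ T), ← gaussianReal_map_const_add, ← h.2 T,
    AEMeasurable.map_map_of_aemeasurable (by fun_prop) h.1.inner_const]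
  rfl

theorem IsGaussianTensor.hasLaw {X : Ω → Tensor n} {μ : Tensor n} {S : Op n n}
    (h : IsGaussianTensor P X μ S) (hS : S.PosSemidef) :
    HasLaw X (multivariateGaussian μ S) P where
  aemeasurable := h.1
  map_eq := by
    have := (h.hasLaw_inner 0).isProbabilityMeasure
    have := Measure.isProbabilityMeasure_map h.1
    refine Measure.ext_of_charFun (funext fun T => ?_)
    have hinner : charFun (P.map X) T = charFun (P.map fun ω => (inner ℝ (X ω) T : ℝ)) 1 := by
      rw [charFun_apply, charFun_apply_real, integral_map h.1 (by fun_prop),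
        integral_map h.1.inner_const (by fun_prop)]
      simp
    rw [hinner, h.2, charFun_gaussianReal, charFun_multivariateGaussian hS]
    have hquad : (inner ℝ (Matrix.toEuclideanLin S T) T : ℝ) = T ⬝ᵥ S *ᵥ T := by
      simp [PiLp.inner_apply, dotProduct, Matrix.toLpLin_apply]
    have hvar : 0 ≤ T.ofLp ⬝ᵥ S *ᵥ T.ofLp :=
      hquad ▸ (Matrix.isPositive_toEuclideanLin_iff.2 hS).inner_nonneg_left T
    simp [hquad, hvar, real_inner_comm]

theorem IsGaussianTensor.congr {X Y : Ω → Tensor n} {μ : Tensor n} {S : Op n n}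
    (h : IsGaussianTensor P X μ S) (hXY : X =ᵐ[P] Y) : IsGaussianTensor P Y μ S := by
  refine ⟨h.1.congr hXY, fun T => ?_⟩
  rw [← h.2 T]
  refine Measure.map_congr ?_
  filter_upwards [hXY] with ω hω
  rw [hω]

theorem posSemidef_smul_one (σ : ℝ) : (σ ^ 2 • (1 : Op n n)).PosSemidef :=
  Matrix.PosSemidef.one.smul (sq_nonneg σ)

theorem posSemidef_tucker_mul_transpose (A : (k : Fin r) → Matrix (Fin (n k)) (Fin (m k)) ℝ) :
    (tucker A * (tucker A)ᵀ).PosSemidef :=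
  Matrix.posSemidef_self_mul_conjTranspose (tucker A)

theorem posSemidef_cov (A : (k : Fin r) → Matrix (Fin (n k)) (Fin (m k)) ℝ) (σ : ℝ) :
    (cov A σ).PosSemidef :=
  (posSemidef_smul_one σ).add (posSemidef_tucker_mul_transpose A)

theorem IsTPCA.isGaussianTensor {X : Ω → Tensor n} {μ : Tensor n}
    {A : (k : Fin r) → Matrix (Fin (n k)) (Fin (m k)) ℝ} {σ : ℝ} (h : IsTPCA P X μ A σ) :
    IsGaussianTensor P X μ (cov A σ) := by
  obtain ⟨-, Z, ε, hZ, hε, hind, hX⟩ := h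
  have hsignal := hZ.toEuclideanLin (tucker A)
  rw [map_zero, Matrix.mul_one] at hsignal
  have hcont : Continuous (Matrix.toEuclideanLin (tucker A)) :=
    LinearMap.continuous_of_finiteDimensional _
  have hsum := (hε.add hsignal (hind.symm.comp measurable_id hcont.measurable)
    (posSemidef_smul_one σ) (posSemidef_tucker_mul_transpose A)).const_add μ
  rw [add_zero, add_zero] at hsum
  refine hsum.congr ?_
  filter_upwards [hX] with ω hω
  rw [hω, add_right_comm, add_assoc]

end Model

/-! ### The covariance operator and the trace of the sample covariance -/

theorem abs_eigenvalues_le_opNorm {ι : Type*} [Fintype ι] [DecidableEq ι]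
    {M : Matrix ι ι ℝ} (hM : M.IsHermitian) (j : ι) : |hM.eigenvalues j| ≤ opNorm M := by
  set v := hM.eigenvectorBasis j
  have hv : Matrix.toEuclideanLin M v = hM.eigenvalues j • v := by
    ext i
    exact congrFun (hM.mulVec_eigenvectorBasis j) i
  simpa [v, opNorm, hv, norm_smul] using
    (LinearMap.toContinuousLinearMap (Matrix.toEuclideanLin M)).le_opNorm v

theorem eq_zero_of_opNorm_eq_zero {ι : Type*} [Fintype ι] [DecidableEq ι]
    {M : Matrix ι ι ℝ} (hM : opNorm M = 0) : M = 0 := by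
  simpa [opNorm] using hM

section Covariance

variable {r : ℕ} {n m : Fin r → ℕ}

theorem card_idx (n : Fin r → ℕ) : (Fintype.card (Idx n) : ℝ) = ∏ k, (n k : ℝ) := by
  simp [Idx]

theorem prod_natCast_mono (hmn : ∀ k, m k ≤ n k) : ∏ k, (m k : ℝ) ≤ ∏ k, (n k : ℝ) :=
  Finset.prod_le_prod (fun _ _ => Nat.cast_nonneg _) fun k _ => Nat.cast_le.2 (hmn k)

theorem trace_sampleCov {N : ℕ} (x : Fin N → Tensor n) :
    (sampleCov x).trace = 1 / (N : ℝ) * ∑ i, ‖x i‖ ^ 2 := by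
  simp only [Matrix.trace, Matrix.diag, sampleCov, Matrix.of_apply, EuclideanSpace.norm_sq_eq]
  rw [← Finset.mul_sum, Finset.sum_comm]
  simp [sq]

variable {A : (k : Fin r) → Matrix (Fin (n k)) (Fin (m k)) ℝ}

theorem sampleCov_eq_tucker_gram_add_noise (σ : ℝ) {N : ℕ} (x : Fin N → Tensor n) :
    sampleCov x = tucker (gram A) + noise A σ x := by
  rw [noise, cov, tucker_mul_transpose]
  abel

theorem trace_cov (σ : ℝ) :
    (cov A σ).trace = (∏ k, (n k : ℝ)) * σ ^ 2 + (tucker (gram A)).trace := by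
  rw [cov, Matrix.trace_add, tucker_mul_transpose, Matrix.trace_smul, Matrix.trace_one, card_idx,
    smul_eq_mul, mul_comm]

theorem rank_cov_sub_smul_one_le (σ : ℝ) : (cov A σ - σ ^ 2 • 1).rank ≤ ∏ k, m k := by
  rw [cov, add_sub_cancel_left]
  refine (Matrix.rank_mul_le_left _ _).trans ((Matrix.rank_le_card_width _).trans_eq ?_)
  simp [Idx]

theorem one_le_of_signal_pos (hsignal : 0 < signal A) (k : Fin r) : 1 ≤ m k := by
  by_contra! hk
  have hempty : IsEmpty (Fin (m k)) := by
    rw [Nat.lt_one_iff.1 hk]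
    infer_instance
  have hgram : gram A k = 0 := by
    ext a b
    simp [gram, Matrix.mul_apply]
  simpa [hgram, frob_eq_sqrt] using frob_gram_pos hsignal k

theorem trace_tucker_gram_pos (hsignal : 0 < signal A) : 0 < (tucker (gram A)).trace := by
  rw [trace_tucker]
  refine Finset.prod_pos fun k _ => (gram_posSemidef A k).trace_nonneg.lt_of_ne' fun htrace => ?_
  have hgram : gram A k = 0 := (gram_posSemidef A k).trace_eq_zero_iff.1 htrace
  simpa [hgram, frob_eq_sqrt] using frob_gram_pos hsignal k

theorem opNorm_cov_pos (hsignal : 0 < signal A) (σ : ℝ) : 0 < opNorm (cov A σ) := by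
  refine (norm_nonneg _).lt_of_ne' fun hzero => ?_
  have htrace := trace_cov (A := A) σ
  rw [eq_zero_of_opNorm_eq_zero hzero, Matrix.trace_zero] at htrace
  have hgram := trace_tucker_gram_pos hsignal
  exact htrace.not_lt (by positivity)

theorem sq_le_opNorm_cov (hn : ∀ k, 1 ≤ n k) (σ : ℝ) : σ ^ 2 ≤ opNorm (cov A σ) := by
  have hpos : 0 < ∏ k, (n k : ℝ) := Finset.prod_pos fun k _ => Nat.cast_pos.2 (hn k)
  have hgram : 0 ≤ (tucker (gram A)).trace := by
    rw [trace_tucker]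
    exact Finset.prod_nonneg fun k _ => (gram_posSemidef A k).trace_nonneg
  refine le_of_mul_le_mul_left ?_ hpos
  calc (∏ k, (n k : ℝ)) * σ ^ 2
      ≤ (cov A σ).trace := by rw [trace_cov]; exact le_add_of_nonneg_right hgram
    _ = ∑ j, (posSemidef_cov A σ).1.eigenvalues j := by
        simpa using (posSemidef_cov A σ).1.trace_eq_sum_eigenvalues
    _ ≤ ∑ _j : Idx n, opNorm (cov A σ) :=
        Finset.sum_le_sum fun j _ => (le_abs_self _).trans (abs_eigenvalues_le_opNorm _ j)
    _ = (∏ k, (n k : ℝ)) * opNorm (cov A σ) := by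
        rw [Finset.sum_const, Finset.card_univ, nsmul_eq_mul, card_idx]

theorem effDim_mul_opNorm_cov (hsignal : 0 < signal A) (σ : ℝ) :
    effDim A σ * opNorm (cov A σ) = (∏ k, (m k : ℝ)) * opNorm (cov A σ) ^ 2
      + ((∏ k, (n k : ℝ)) - ∏ k, (m k : ℝ)) * (σ ^ 2) ^ 2 := by
  have hL := (opNorm_cov_pos hsignal σ).ne'
  rw [effDim]
  field_simp

theorem sum_eigenvalues_cov_sq_le (hn : ∀ k, 1 ≤ n k) (hsignal : 0 < signal A) (σ : ℝ) :
    ∑ j, (posSemidef_cov A σ).1.eigenvalues j ^ 2 ≤ effDim A σ * opNorm (cov A σ) := by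
  have hσ : |σ ^ 2| ≤ opNorm (cov A σ) := by
    simpa [abs_of_nonneg (sq_nonneg σ)] using sq_le_opNorm_cov hn σ
  rw [effDim_mul_opNorm_cov hsignal, ← card_idx n, ← Nat.cast_prod]
  exact sum_eigenvalues_sq_le _ (rank_cov_sub_smul_one_le σ) hσ (abs_eigenvalues_le_opNorm _)

theorem effDim_pos (hmn : ∀ k, m k ≤ n k) (hsignal : 0 < signal A) (σ : ℝ) :
    0 < effDim A σ := by
  have hL := opNorm_cov_pos hsignal σ
  have hm : 0 < ∏ k, (m k : ℝ) :=
    Finset.prod_pos fun k _ => Nat.cast_pos.2 (one_le_of_signal_pos hsignal k)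
  have hle := sub_nonneg.2 (prod_natCast_mono hmn)
  exact add_pos_of_pos_of_nonneg (mul_pos hm hL)
    (div_nonneg (mul_nonneg hle (by positivity)) hL.le)

theorem effDim_le (hmn : ∀ k, m k ≤ n k) (hsignal : 0 < signal A) (σ : ℝ) :
    effDim A σ ≤ (∏ k, (n k : ℝ)) * opNorm (cov A σ) := by
  have hL := opNorm_cov_pos hsignal σ
  have hσ : (σ ^ 2) ^ 2 ≤ opNorm (cov A σ) ^ 2 :=
    pow_le_pow_left₀ (sq_nonneg σ)
      (sq_le_opNorm_cov (fun k => (one_le_of_signal_pos hsignal k).trans (hmn k)) σ) 2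
  have hle := sub_nonneg.2 (prod_natCast_mono hmn)
  refine le_of_mul_le_mul_right ?_ hL
  rw [effDim_mul_opNorm_cov hsignal]
  linarith [mul_le_mul_of_nonneg_left hσ hle]

variable {Ω : Type*} [MeasurableSpace Ω] {P : Measure Ω}

theorem measureReal_effDim_mul_lt_abs_trace_sub_le (hmn : ∀ k, m k ≤ n k)
    (hsignal : 0 < signal A) {σ : ℝ} {N : ℕ} (hN : 0 < N) {X : Fin N → Ω → Tensor n}
    (hX : ∀ i, IsTPCA P (X i) 0 A σ) (hindep : iIndepFun X P) :
    P.real {ω | effDim A σ * maxSqrt (alpha₄ A σ N) <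
        |(sampleCov fun i => X i ω).trace - (cov A σ).trace|} ≤
      1 / ((N : ℝ) ^ 2 * (∏ k, (n k : ℝ)) ^ 2) := by
  have hN' : (0 : ℝ) < N := Nat.cast_pos.2 hN
  have hL := opNorm_cov_pos hsignal σ
  have hD := effDim_pos hmn hsignal σ
  have hn : ∀ k, 1 ≤ n k := fun k => (one_le_of_signal_pos hsignal k).trans (hmn k)
  have hQ : Fintype.card (Fin N) * ∑ j, (posSemidef_cov A σ).1.eigenvalues j ^ 2 ≤
      N * effDim A σ / opNorm (cov A σ) * opNorm (cov A σ) ^ 2 := by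
    calc Fintype.card (Fin N) * ∑ j, (posSemidef_cov A σ).1.eigenvalues j ^ 2
        ≤ N * (effDim A σ * opNorm (cov A σ)) := by
          rw [Fintype.card_fin]
          gcongr
          exact sum_eigenvalues_cov_sq_le hn hsignal σ
      _ = _ := by field_simp
  have hQd : N * effDim A σ / opNorm (cov A σ) ≤ (N * ∏ k, n k : ℕ) := by
    rw [div_le_iff₀ hL, Nat.cast_mul, Nat.cast_prod, mul_assoc]
    exact mul_le_mul_of_nonneg_left (effDim_le hmn hsignal σ) hN'.le
  have hα : 0.145 * (N * effDim A σ / opNorm (cov A σ) * alpha₄ A σ N) =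
      2 * Real.log (N * ∏ k, n k : ℕ) := by
    rw [alpha₄, Nat.cast_mul, Nat.cast_prod]
    field_simp
  have htail := measureReal_abs_sum_norm_sq_sub_trace_lt_le
    (fun i => (hX i).isGaussianTensor.hasLaw (posSemidef_cov A σ)) hindep (posSemidef_cov A σ) hL
    (fun j => (le_abs_self _).trans (abs_eigenvalues_le_opNorm _ j)) (by positivity) hQ hQd hα
  rw [Nat.cast_mul, Nat.cast_prod, mul_pow] at htail
  convert htail using 4 with ω
  rw [trace_sampleCov, div_mul_cancel₀ _ hL.ne', mul_assoc, Fintype.card_fin, ← lt_div_iff₀' hN',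
    ← abs_of_pos hN', ← abs_div, abs_of_pos hN', sub_div, mul_div_cancel_left₀ _ hN'.ne',
    one_div_mul_eq_div]

end Covariance

section Residual

variable {r : ℕ} {n m : Fin r → ℕ} {A : (k : Fin r) → Matrix (Fin (n k)) (Fin (m k)) ℝ}
  {S : Op n n} {B B' : (k : Fin r) → Matrix (Fin (n k)) (Fin (n k)) ℝ} {σ : ℝ}

theorem sigmaSqHat_sub_sq (hn : (∏ k, (n k : ℝ)) ≠ 0) :
    sigmaSqHat S B' - σ ^ 2 =
      ((S.trace - (cov A σ).trace) -
        ((tucker (gramHat S B')).trace - (tucker (gram A)).trace)) / ∏ k, (n k : ℝ) := by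
  rw [sigmaSqHat, Matrix.trace_sub, trace_cov]
  field_simp
  ring

theorem IsIteration.abs_sigmaSqHat_sub_sq_le (hr : 0 < r) (hn : 0 < ∏ k, (n k : ℝ))
    (hscale : ∀ k l, frob (gram A k) = frob (gram A l)) (hsignal : 0 < signal A) {F : Op n n}
    (hS : S = tucker (gram A) + F) {ρ τ t : ℝ} (hF : mlNorm F ≤ ρ * signal A)
    (hτ : τ < tauOne r (∏ k, (m k : ℝ)) ρ) (htrace : |S.trace - (cov A σ).trace| ≤ t)
    (hB : IsFeasible m B) (hsin : ∀ k, Real.sin (initAngle A k (B k)) ≤ τ)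
    (hit : IsIteration m S B B') :
    |sigmaSqHat S B' - σ ^ 2| ≤
      √(∏ k, (m k : ℝ)) * signal A / (∏ k, (n k : ℝ)) *
        ((1 + 2 * f₁ r (∏ k, (m k : ℝ)) ρ τ + √2 * f₂ r (∏ k, (m k : ℝ)) ρ τ) ^ r - 1)
        + t / ∏ k, (n k : ℝ) := by
  subst hS
  rw [sigmaSqHat_sub_sq (A := A) hn.ne', abs_div, abs_of_pos hn, div_mul_eq_mul_div, ← add_div]
  gcongr
  refine (abs_sub _ _).trans ?_
  rw [add_comm]
  exact add_le_add (hit.abs_trace_tucker_gramHat_sub_le hr hscale hsignal hF hτ hB hsin) htrace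

end Residual

end TPCA

theorem mainTheorem5_general {Ω : Type*} [MeasurableSpace Ω] (P : Measure Ω)
    [IsProbabilityMeasure P] {r : ℕ} (hr : 0 < r) (n m : Fin r → ℕ) (hmn : ∀ k, m k ≤ n k)
    (A : (k : Fin r) → Matrix (Fin (n k)) (Fin (m k)) ℝ) (σ : ℝ)
    (N : ℕ) (hN : 0 < N) (X : Fin N → Ω → TPCA.Tensor n)
    (hX : ∀ i, TPCA.IsTPCA P (X i) 0 A σ) (hindep : iIndepFun X P)
    (hscale : ∀ k l, TPCA.frob (TPCA.gram A k) = TPCA.frob (TPCA.gram A l))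
    (hsignal : 0 < TPCA.signal A)
    (ψ τ : ℝ) (hτ : τ < TPCA.tauOne r (∏ k, (m k : ℝ)) (ψ / TPCA.signal A)) :
    ∃ G : Set Ω, MeasurableSet G ∧
      1 - ENNReal.ofReal (1 / ((N : ℝ) ^ 2 * (∏ k, (n k : ℝ)) ^ 2)) ≤ P G ∧
      ∀ ω ∈ G,
        TPCA.mlNorm (TPCA.noise A σ fun i => X i ω) ≤ ψ →
        ∀ B₀ B₁ : (k : Fin r) → Matrix (Fin (n k)) (Fin (n k)) ℝ,
          TPCA.IsFeasible m B₀ →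
          (∀ k, Real.sin (TPCA.initAngle A k (B₀ k)) ≤ τ) →
          TPCA.IsIteration m (TPCA.sampleCov fun i => X i ω) B₀ B₁ →
          |TPCA.sigmaSqHat (TPCA.sampleCov fun i => X i ω) B₁ - σ ^ 2| ≤
            Real.sqrt (∏ k, (m k : ℝ)) * TPCA.signal A / (∏ k, (n k : ℝ)) *
              ((1 + 2 * TPCA.f₁ r (∏ k, (m k : ℝ)) (ψ / TPCA.signal A) τ
                + Real.sqrt 2 * TPCA.f₂ r (∏ k, (m k : ℝ)) (ψ / TPCA.signal A) τ) ^ r - 1)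
              + TPCA.t₄ A σ N := by
  have hn : 0 < ∏ k, (n k : ℝ) := Finset.prod_pos fun k _ =>
    Nat.cast_pos.2 ((TPCA.one_le_of_signal_pos hsignal k).trans (hmn k))
  set bad : Set Ω := {ω | TPCA.effDim A σ * TPCA.maxSqrt (TPCA.alpha₄ A σ N) <
    |(TPCA.sampleCov fun i => X i ω).trace - (TPCA.cov A σ).trace|}
  have hbad := TPCA.measureReal_effDim_mul_lt_abs_trace_sub_le hmn hsignal hN hX hindep
  refine ⟨(toMeasurable P bad)ᶜ, (measurableSet_toMeasurable P bad).compl, ?_, ?_⟩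
  · rw [prob_compl_eq_one_sub (measurableSet_toMeasurable P bad), measure_toMeasurable,
      ← ofReal_measureReal]
    gcongr
  · intro ω hω hnoise B₀ B₁ hB hsin hit
    have htrace : |(TPCA.sampleCov fun i => X i ω).trace - (TPCA.cov A σ).trace| ≤
        TPCA.effDim A σ * TPCA.maxSqrt (TPCA.alpha₄ A σ N) :=
      not_lt.1 fun h => hω (subset_toMeasurable P bad h)
    rw [TPCA.t₄, div_mul_eq_mul_div (TPCA.effDim A σ)]
    exact hit.abs_sigmaSqHat_sub_sq_le hr hn hscale hsignal
      (TPCA.sampleCov_eq_tucker_gram_add_noise σ _)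
      (hnoise.trans_eq (div_mul_cancel₀ ψ hsignal.ne').symm) hτ htrace hB hsin

theorem mainTheorem5 {Ω : Type*} [MeasurableSpace Ω] (P : Measure Ω) [IsProbabilityMeasure P]
    {r : ℕ} (hr : 2 ≤ r) (n m : Fin r → ℕ) (hmn : ∀ k, m k ≤ n k)
    (A : (k : Fin r) → Matrix (Fin (n k)) (Fin (m k)) ℝ) (σ : ℝ) (hσ : 0 ≤ σ)
    -- the sample: independent copies from the model with mean zero
    (N : ℕ) (hN : 0 < N) (X : Fin N → Ω → TPCA.Tensor n)
    (hX : ∀ i, TPCA.IsTPCA P (X i) 0 A σ) (hindep : iIndepFun X P)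
    -- equal scaling, with non-degenerate signal
    (hscale : ∀ k l, TPCA.frob (TPCA.gram A k) = TPCA.frob (TPCA.gram A l))
    (hsignal : 0 < TPCA.signal A)
    -- the noise level `ψ`
    (δ₁ δ₂ δ₃ : ℝ) (hδ₁ : δ₁ ∈ Set.Ioo (0 : ℝ) 1) (hδ₂ : δ₂ ∈ Set.Ioo (0 : ℝ) 1)
    (hδ₃ : δ₃ ∈ Set.Ioo (0 : ℝ) 1)
    (ψ : ℝ) (hψ : ψ = TPCA.psi A σ N δ₁ δ₂ δ₃)
    -- the signal-to-noise condition and the range of `τ`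
    (hsnr : (ψ / TPCA.signal A) ^ 2 <
      1 / (32 * ∏ k, (m k : ℝ)) * (1 / (r : ℝ)) * (1 - 1 / (r : ℝ)) ^ (r - 1))
    (τ : ℝ) (hτ : 0 < τ) (hτ₁ : τ < TPCA.tauOne r (∏ k, (m k : ℝ)) (ψ / TPCA.signal A)) :
    ∃ G : Set Ω, MeasurableSet G ∧
      1 - ENNReal.ofReal (1 / ((N : ℝ) ^ 2 * (∏ k, (n k : ℝ)) ^ 2)) ≤ P G ∧
      ∀ ω ∈ G,
        -- the event `E(ψ)`
        TPCA.mlNorm (TPCA.noise A σ fun i => X i ω) ≤ ψ →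
        -- every admissible initialization, and every outcome of one iteration started from it
        ∀ B₀ B₁ : (k : Fin r) → Matrix (Fin (n k)) (Fin (n k)) ℝ,
          TPCA.IsFeasible m B₀ →
          (∀ k, Real.sin (TPCA.initAngle A k (B₀ k)) ≤ τ) →
          TPCA.IsIteration m (TPCA.sampleCov fun i => X i ω) B₀ B₁ →
          |TPCA.sigmaSqHat (TPCA.sampleCov fun i => X i ω) B₁ - σ ^ 2| ≤
            Real.sqrt (∏ k, (m k : ℝ)) * TPCA.signal A / (∏ k, (n k : ℝ)) *
              ((1 + 2 * TPCA.f₁ r (∏ k, (m k : ℝ)) (ψ / TPCA.signal A) τ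
                + Real.sqrt 2 * TPCA.f₂ r (∏ k, (m k : ℝ)) (ψ / TPCA.signal A) τ) ^ r - 1)
              + TPCA.t₄ A σ N :=
  mainTheorem5_general P (by omega) n m hmn A σ N hN X hX hindep hscale hsignal ψ τ hτ₁
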